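/- Let $\Gamma\subset \mathrm{PSL}(2,\mathbb R)$ be a torsion-free discrete group (a torsion-free Fuchsian group) acting on the upper half-plane $\mathbb H$, which is nonelementary (it has no finite orbit in $\mathbb H\cup\partial\mathbb H$, $\partial\mathbb H=\mathbb R\cup\{\infty\}$) and contains a parabolic element; that is, $S=\Gamma\backslash\mathbb H$ is a nonelementary hyperbolic surface with at least one cusp. Let $g_t$ be the geodesic flow on $T^1S=\Gamma\backslash T^1\mathbb H$, and let $\mathrm{NW}(g_t)\subset T^1S$ be its nonwandering set, i.e. the set of all $v$ such that for every neighbourhood $U$ of $v$ there are arbitrarily large $t$ with $g_tU\cap U\neq\emptyset$. For $u\in T^1S$ write $u(t)\in S$ for the base point of $g_tu$. A cusp of $S$ is the injective projection to $S$ of $\Gamma_\xi\backslash B$, where $B$ is an open horoball centered at a fixed point $\xi$ of a parabolic element of $\Gamma$ and $\Gamma_\xi$ is the stabilizer of $\xi$ in $\Gamma$. A closed horocycle of $S$ is the projection of a horocycle $\tilde H$ of $\mathbb H$, parametrized by arc length as $s\mapsto \tilde H(s)$, for which there are $\gamma\in\Gamma$ and $l>0$ with $\gamma \tilde H(s)=\tilde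 H(s+l)$ for all $s\in\mathbb R$; its length is the least such $l$. A vector $u\in T^1S$ is called cusp-recurrent if the ray $u(\mathbb R^+)=\{u(t):t\ge 0\}$ does not escape to infinity through a cusp (i.e. it is not the case that $u(t)$ leaves every compact subset of $S$ and lies in some fixed cusp for all large $t$) and $u(\mathbb R^+)$ intersects closed horocycles of arbitrarily small length. Then: 1. Every $u\in T^1S$ whose forward orbit is dense in the nonwandering set, i.e. $\mathrm{NW}(g_t)\subset\overline{\{g_tu: t\ge 0\}}$, is cusp-recurrent. 2. The flow is topologically transitive on $\mathrm{NW}(g_t)$: there is $v\in \mathrm{NW}(g_t)$ with $\mathrm{NW}(g_t)\subset\overline{\{g_tv:t\in\mathbb R\}}$. 3. There is a dense $G_\delta$ subset of $\mathrm{NW}(g_t)$ consisting of vectors whose forward orbit is dense in $\mathrm{NW}(g_t)$; in particular all vectors of this set are cusp-recurrent. -/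

import Mathlib

open scoped MatrixGroups UpperHalfPlane Topology OnePoint
open Filter

namespace CuspRecurrence

noncomputable section

/-! ### The unit tangent bundle of the hyperbolic plane -/

/-- The unit tangent bundle of the upper half-plane with the metric `(dx² + dy²) / y²`: pairs
`(z, w)` of a point `z` and a tangent vector `w ∈ ℂ` at `z` with `‖w‖ / Im z = 1`.
It carries the topology induced from `ℍ × ℂ`. -/
def UnitTangent : Type := {q : ℍ × ℂ // ‖q.2‖ = q.1.im}

instance : TopologicalSpace UnitTangent :=
  inferInstanceAs (TopologicalSpace {q : ℍ × ℂ // ‖q.2‖ = q.1.im})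

namespace UnitTangent

/-- The base point of a unit tangent vector. -/
def pt (v : UnitTangent) : ℍ := v.1.1

/-- The vector part of a unit tangent vector. -/
def vec (v : UnitTangent) : ℂ := v.1.2

theorem norm_vec (v : UnitTangent) : ‖v.vec‖ = v.pt.im := v.2

theorem ext {v w : UnitTangent} (h₁ : v.pt = w.pt) (h₂ : v.vec = w.vec) : v = w :=
  Subtype.ext (Prod.ext h₁ h₂)

end UnitTangent

/-- The automorphy factor `c z + d` of `g = !![a, b; c, d]`; the derivative of the Möbius
transformation `g` at `z` is `1 / (c z + d) ^ 2`. -/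
def den (g : SL(2, ℝ)) (z : ℍ) : ℂ := (g 1 0 : ℂ) * z + (g 1 1 : ℂ)

theorem den_eq (g : SL(2, ℝ)) (z : ℍ) : den g z = UpperHalfPlane.denom (g : GL (Fin 2) ℝ) z := rfl

theorem den_ne_zero (g : SL(2, ℝ)) (z : ℍ) : den g z ≠ 0 := by
  rw [den_eq]; exact UpperHalfPlane.denom_ne_zero _ _

theorem im_smul_eq (g : SL(2, ℝ)) (z : ℍ) : (g • z).im = z.im / ‖den g z‖ ^ 2 := by
  have h := UpperHalfPlane.im_smul_eq_div_normSq (g : GL (Fin 2) ℝ) z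
  rw [den_eq, ← Complex.normSq_eq_norm_sq]
  have e : (g • z : ℍ) = (g : GL (Fin 2) ℝ) • z := rfl
  rw [e]
  simpa using h

theorem den_mul (g h : SL(2, ℝ)) (z : ℍ) : den (g * h) z = den g (h • z) * den h z := by
  have e := UpperHalfPlane.denom_cocycle_σ (g : GL (Fin 2) ℝ) (h : GL (Fin 2) ℝ) z
  have e' : (h • z : ℍ) = (h : GL (Fin 2) ℝ) • z := rfl
  rw [e']
  simpa [den_eq, UpperHalfPlane.σ] using e

/-- `SL(2, ℝ)` acts on the unit tangent bundle by the derivatives of the Möbius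
transformations. -/
instance : MulAction SL(2, ℝ) UnitTangent where
  smul g v := ⟨(g • v.pt, v.vec / den g v.pt ^ 2), by
    change ‖v.vec / den g v.pt ^ 2‖ = (g • v.pt).im
    rw [im_smul_eq, norm_div, norm_pow, v.norm_vec]⟩
  one_smul v := by
    refine UnitTangent.ext (one_smul _ v.pt) ?_
    change v.vec / den 1 v.pt ^ 2 = v.vec
    simp [den]
  mul_smul g h v := by
    refine UnitTangent.ext (mul_smul g h v.pt) ?_
    change v.vec / den (g * h) v.pt ^ 2 = v.vec / den h v.pt ^ 2 / den g (h • v.pt) ^ 2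
    rw [den_mul, mul_pow, div_div, mul_comm]

theorem pt_smul (g : SL(2, ℝ)) (v : UnitTangent) : (g • v).pt = g • v.pt := rfl

theorem vec_smul (g : SL(2, ℝ)) (v : UnitTangent) :
    (g • v).vec = v.vec / den g v.pt ^ 2 := rfl

/-! ### The geodesic flow on the unit tangent bundle of the hyperbolic plane -/

/-- The unit speed geodesic `t ↦ i eᵗ` together with its velocity vector `i eᵗ` at time `t`. -/
def vertical (t : ℝ) : UnitTangent :=
  ⟨(⟨Complex.I * Real.exp t, by
    simpa [-Complex.ofReal_exp] using Real.exp_pos t⟩, Complex.I * Real.exp t), by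
    simp [UpperHalfPlane.im, -Complex.ofReal_exp]⟩

theorem pt_vertical_zero : (vertical 0).pt = UpperHalfPlane.I := by
  ext; simp [vertical, UnitTangent.pt]

theorem vec_vertical_zero : (vertical 0).vec = Complex.I := by
  simp [vertical, UnitTangent.vec]

theorem exists_smul_vertical (v : UnitTangent) : ∃ g : SL(2, ℝ), g • vertical 0 = v := by
  set θ : ℝ := Complex.arg (v.vec / Complex.I) with hθ
  set a : ℝ := -(θ / 2) with ha
  let k : SL(2, ℝ) := ⟨!![Real.cos a, -Real.sin a; Real.sin a, Real.cos a], by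
    rw [Matrix.det_fin_two_of]; nlinarith [Real.sin_sq_add_cos_sq a]⟩
  have hden : den k UpperHalfPlane.I = Complex.exp (a * Complex.I) := by
    rw [Complex.exp_mul_I]
    simp [den, k]
    ring
  have hkI : k • UpperHalfPlane.I = UpperHalfPlane.I := by
    apply UpperHalfPlane.ext
    rw [UpperHalfPlane.coe_specialLinearGroup_apply]
    have h0 := den_ne_zero k UpperHalfPlane.I
    simp only [den] at h0
    simp only [Algebra.algebraMap_self, RingHom.id_apply]
    rw [div_eq_iff h0]
    simp [k]
    linear_combination (-(Complex.sin a)) * Complex.I_sq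
  have hden' : den v.pt.toSL2R UpperHalfPlane.I = 1 / (Real.sqrt v.pt.im : ℂ) := by
    simp [den]
  refine ⟨v.pt.toSL2R * k, UnitTangent.ext ?_ ?_⟩
  · rw [pt_smul, pt_vertical_zero, mul_smul, hkI, UpperHalfPlane.toSL2R_smul_I]
  · have hs : ((Real.sqrt v.pt.im : ℝ) : ℂ) ^ 2 = (v.pt.im : ℂ) := by
      rw [← Complex.ofReal_pow, Real.sq_sqrt v.pt.im_pos.le]
    have hw : (v.pt.im : ℂ) * Complex.exp (θ * Complex.I) = v.vec / Complex.I := by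
      have := Complex.norm_mul_exp_arg_mul_I (v.vec / Complex.I)
      rwa [norm_div, Complex.norm_I, div_one, v.norm_vec] at this
    have he : Complex.exp (θ * Complex.I) * Complex.exp (a * Complex.I) ^ 2 = 1 := by
      rw [← Complex.exp_nat_mul, ← Complex.exp_add, ha, Complex.exp_eq_one_iff]
      exact ⟨0, by push_cast; ring⟩
    rw [vec_smul, pt_vertical_zero, vec_vertical_zero, den_mul, hkI, hden, hden', mul_pow, div_pow,
      hs, one_pow, div_eq_iff (mul_ne_zero (one_div_ne_zero (by exact_mod_cast v.pt.im_ne_zero))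
        (pow_ne_zero _ (Complex.exp_ne_zero _)))]
    have hy : (v.pt.im : ℂ) ≠ 0 := by exact_mod_cast v.pt.im_ne_zero
    have hv : v.vec = Complex.I * (v.pt.im * Complex.exp (θ * Complex.I)) := by
      rw [hw]; field_simp
    generalize Complex.exp (θ * Complex.I) = E at he hv
    generalize Complex.exp (a * Complex.I) = A at he
    rw [hv]
    field_simp
    linear_combination -he

theorem eq_one_or_neg_one {g : SL(2, ℝ)} (h : g • vertical 0 = vertical 0) :
    g = 1 ∨ g = -1 := by
  have h1 := congrArg UnitTangent.pt h
  have h2 := congrArg UnitTangent.vec h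
  rw [pt_smul, pt_vertical_zero] at h1
  rw [vec_smul, pt_vertical_zero, vec_vertical_zero] at h2
  have hd := den_ne_zero g UpperHalfPlane.I
  have h3 : den g UpperHalfPlane.I ^ 2 = 1 := by
    rw [div_eq_iff (pow_ne_zero _ hd)] at h2
    exact (mul_left_cancel₀ Complex.I_ne_zero (by rw [← h2, mul_one])).symm
  have h4 := congrArg UpperHalfPlane.coe h1
  rw [UpperHalfPlane.coe_specialLinearGroup_apply] at h4
  simp only [Algebra.algebraMap_self, RingHom.id_apply] at h4
  simp only [den] at hd
  rw [div_eq_iff hd] at h4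
  have key : den g UpperHalfPlane.I = 1 ∨ den g UpperHalfPlane.I = -1 := by
    rcases mul_eq_zero.mp (show (den g UpperHalfPlane.I - 1) * (den g UpperHalfPlane.I + 1) = 0 by
      linear_combination h3) with e | e
    · exact Or.inl (sub_eq_zero.mp e)
    · exact Or.inr (eq_neg_of_add_eq_zero_left e)
  have r4 := congrArg Complex.re h4
  have i4 := congrArg Complex.im h4
  rcases key with e | e
  · left
    have er := congrArg Complex.re e
    have ei := congrArg Complex.im e
    simp [den] at er ei r4 i4
    ext i j
    fin_cases i <;> fin_cases j <;> simp <;> linarith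
  · right
    have er := congrArg Complex.re e
    have ei := congrArg Complex.im e
    simp [den] at er ei r4 i4
    ext i j
    fin_cases i <;> fin_cases j <;> simp <;> linarith

theorem neg_one_smul (v : UnitTangent) : (-1 : SL(2, ℝ)) • v = v := by
  refine UnitTangent.ext ?_ ?_
  · rw [pt_smul]
    apply UpperHalfPlane.ext
    rw [UpperHalfPlane.coe_specialLinearGroup_apply]
    simp
  · rw [vec_smul]
    simp [den]

/-- The geodesic flow on the unit tangent bundle of the hyperbolic plane. The unit speed geodesic
with initial vector `g • vertical 0` has velocity `g • vertical t` at time `t`; every unit tangent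
vector is of the form `g • vertical 0`, and the result does not depend on `g`
(see `flow_smul_vertical`). -/
def flow (t : ℝ) (v : UnitTangent) : UnitTangent :=
  (exists_smul_vertical v).choose • vertical t

theorem flow_smul_vertical (t : ℝ) (g : SL(2, ℝ)) :
    flow t (g • vertical 0) = g • vertical t := by
  have h := (exists_smul_vertical (g • vertical 0)).choose_spec
  unfold flow
  set k := (exists_smul_vertical (g • vertical 0)).choose
  have h' : (g⁻¹ * k) • vertical 0 = vertical 0 := by rw [mul_smul, h, inv_smul_smul]
  have hk : (g⁻¹ * k) • vertical t = vertical t := by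
    rcases eq_one_or_neg_one h' with e | e <;> rw [e]
    · exact one_smul _ _
    · exact neg_one_smul _
  rw [mul_smul, inv_smul_eq_iff] at hk
  exact hk

theorem flow_smul (t : ℝ) (g : SL(2, ℝ)) (v : UnitTangent) : flow t (g • v) = g • flow t v := by
  obtain ⟨k, rfl⟩ := exists_smul_vertical v
  rw [← mul_smul, flow_smul_vertical, flow_smul_vertical, mul_smul]

/-! ### Fuchsian groups and hyperbolic surfaces

A subgroup of `PSL(2, ℝ)` is represented by a subgroup `Γ` of `SL(2, ℝ)` which maps onto it; both
`±1` act trivially on `ℍ` and on its unit tangent bundle. -/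

/-- `Γ` is discrete, and its image in `PSL(2, ℝ) = SL(2, ℝ) / {±1}` is torsion-free. -/
structure IsTorsionFreeFuchsian (Γ : Subgroup SL(2, ℝ)) : Prop where
  discrete : DiscreteTopology Γ
  torsionFree : ∀ γ ∈ Γ, IsOfFinOrder γ → γ = 1 ∨ γ = -1

/-- `Γ` is nonelementary: it has no finite orbit in `ℍ ∪ ∂ℍ`, where `∂ℍ = ℝ ∪ {∞}`. -/
def IsNonelementary (Γ : Subgroup SL(2, ℝ)) : Prop :=
  (∀ z : ℍ, {w : ℍ | ∃ γ ∈ Γ, γ • z = w}.Infinite) ∧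
    ∀ ξ : OnePoint ℝ, {η : OnePoint ℝ | ∃ γ ∈ Γ, (γ : GL (Fin 2) ℝ) • ξ = η}.Infinite

/-- `ξ ∈ ∂ℍ` is fixed by a parabolic element of `Γ`. -/
def IsParabolicFixedPoint (Γ : Subgroup SL(2, ℝ)) (ξ : OnePoint ℝ) : Prop :=
  ∃ p ∈ Γ, (p : GL (Fin 2) ℝ).IsParabolic ∧ (p : GL (Fin 2) ℝ) • ξ = ξ

/-- The surface `S = Γ \ ℍ`, with the quotient topology. -/
def Surface (Γ : Subgroup SL(2, ℝ)) : Type := Quotient (MulAction.orbitRel Γ ℍ)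

instance (Γ : Subgroup SL(2, ℝ)) : TopologicalSpace (Surface Γ) :=
  inferInstanceAs (TopologicalSpace (Quotient (MulAction.orbitRel Γ ℍ)))

/-- The unit tangent bundle `T¹S = Γ \ T¹ℍ`, with the quotient topology. -/
def SurfaceUnitTangent (Γ : Subgroup SL(2, ℝ)) : Type :=
  Quotient (MulAction.orbitRel Γ UnitTangent)

instance (Γ : Subgroup SL(2, ℝ)) : TopologicalSpace (SurfaceUnitTangent Γ) :=
  inferInstanceAs (TopologicalSpace (Quotient (MulAction.orbitRel Γ UnitTangent)))

/-- The covering `ℍ → S`. -/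
def toSurface (Γ : Subgroup SL(2, ℝ)) (z : ℍ) : Surface Γ :=
  Quotient.mk (MulAction.orbitRel Γ ℍ) z

/-- The base point projection `T¹S → S`. -/
def basePoint (Γ : Subgroup SL(2, ℝ)) : SurfaceUnitTangent Γ → Surface Γ :=
  Quotient.map' UnitTangent.pt (by
    rintro _ w ⟨γ, rfl⟩
    exact ⟨γ, rfl⟩)

/-- The geodesic flow on `T¹S`. -/
def geodesicFlow (Γ : Subgroup SL(2, ℝ)) (t : ℝ) : SurfaceUnitTangent Γ → SurfaceUnitTangent Γ :=
  Quotient.map' (flow t) (by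
    rintro _ w ⟨γ, rfl⟩
    exact ⟨γ, (flow_smul t (γ : SL(2, ℝ)) w).symm⟩)

/-! ### Nonwandering set and orbits of a flow -/

/-- The nonwandering set of a flow `φ`: the points `x` such that every neighbourhood `U` of `x`
satisfies `φ t (U) ∩ U ≠ ∅` for arbitrarily large times `t`. -/
def nonwanderingSet {X : Type*} [TopologicalSpace X] (φ : ℝ → X → X) : Set X :=
  {x | ∀ U ∈ 𝓝 x, ∀ T : ℝ, ∃ t ≥ T, (φ t '' U ∩ U).Nonempty}

/-- The forward orbit of `x`. -/
def forwardOrbit {X : Type*} (φ : ℝ → X → X) (x : X) : Set X := {y | ∃ t : ℝ, 0 ≤ t ∧ φ t x = y}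

/-- The orbit of `x`. -/
def fullOrbit {X : Type*} (φ : ℝ → X → X) (x : X) : Set X := {y | ∃ t : ℝ, φ t x = y}

/-! ### Horocycles, cusps and cusp-recurrent vectors -/

/-- The exponential of a Busemann function centered at `ξ ∈ ∂ℍ`; its level sets are the horizontal
lines for `ξ = ∞`, and the circles in `ℍ` tangent to the real line at `ξ` for `ξ ∈ ℝ`. -/
def horoHeight : OnePoint ℝ → ℍ → ℝ
  | ∞, z => z.im
  | (x : ℝ), z => z.im / ‖(z : ℂ) - x‖ ^ 2

/-- The horocycles centered at `ξ` (for `0 < h`). -/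
def horocycle (ξ : OnePoint ℝ) (h : ℝ) : Set ℍ := {z | horoHeight ξ z = h}

/-- The open horoballs centered at `ξ` (for `0 < h`). -/
def horoball (ξ : OnePoint ℝ) (h : ℝ) : Set ℍ := {z | h < horoHeight ξ z}

/-- `c` is a parametrization of `H` by hyperbolic arc length (with either orientation). -/
structure IsArcLengthParametrization (c : ℝ → ℍ) (H : Set ℍ) : Prop where
  injective : Function.Injective c
  range_eq : Set.range c = H
  unit_speed : ∀ s : ℝ, ∃ w : ℂ, HasDerivAt (fun s' : ℝ ↦ (c s' : ℂ)) w s ∧ ‖w‖ = (c s).im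

/-- `C` is a closed horocycle in `S` of length `ℓ`: it is the projection of a horocycle of `ℍ`,
parametrized by arc length as `s ↦ c s`, and `ℓ` is the least positive number such that
`γ (c s) = c (s + ℓ)` for all `s`, for some `γ ∈ Γ`. -/
def IsClosedHorocycle (Γ : Subgroup SL(2, ℝ)) (C : Set (Surface Γ)) (ℓ : ℝ) : Prop :=
  ∃ (ξ : OnePoint ℝ) (h : ℝ) (c : ℝ → ℍ), 0 < h ∧
    IsArcLengthParametrization c (horocycle ξ h) ∧
    C = toSurface Γ '' horocycle ξ h ∧
    IsLeast {l : ℝ | 0 < l ∧ ∃ γ ∈ Γ, ∀ s : ℝ, γ • c s = c (s + l)} ℓ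

/-- `C` is a cusp of `S`: the projection of a horoball `B` centered at a parabolic fixed point `ξ`
of `Γ`, such that `Γ_ξ \ B` embeds in `S`, where `Γ_ξ` is the stabilizer of `ξ`. -/
def IsCuspOf (Γ : Subgroup SL(2, ℝ)) (C : Set (Surface Γ)) : Prop :=
  ∃ (ξ : OnePoint ℝ) (h : ℝ), 0 < h ∧ IsParabolicFixedPoint Γ ξ ∧
    (∀ γ ∈ Γ, ∀ z ∈ horoball ξ h, γ • z ∈ horoball ξ h → (γ : GL (Fin 2) ℝ) • ξ = ξ) ∧
    C = toSurface Γ '' horoball ξ h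

/-- The geodesic ray of `u` escapes to infinity through a cusp: it leaves every compact subset
of `S`, and it is eventually contained in a cusp. -/
def EscapesThroughCusp (Γ : Subgroup SL(2, ℝ)) (u : SurfaceUnitTangent Γ) : Prop :=
  Tendsto (fun t : ℝ ↦ basePoint Γ (geodesicFlow Γ t u)) atTop (cocompact (Surface Γ)) ∧
    ∃ C, IsCuspOf Γ C ∧ ∀ᶠ t : ℝ in atTop, basePoint Γ (geodesicFlow Γ t u) ∈ C

/-- `u` is cusp-recurrent: its geodesic ray does not escape to infinity through a cusp, and it
intersects closed horocycles of arbitrarily small length. -/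
def IsCuspRecurrent (Γ : Subgroup SL(2, ℝ)) (u : SurfaceUnitTangent Γ) : Prop :=
  ¬ EscapesThroughCusp Γ u ∧
    ∀ ε > 0, ∃ (C : Set (Surface Γ)) (ℓ : ℝ), IsClosedHorocycle Γ C ℓ ∧ ℓ < ε ∧
      ∃ t : ℝ, 0 ≤ t ∧ basePoint Γ (geodesicFlow Γ t u) ∈ C

end

end CuspRecurrence

namespace CuspRecurrence

/-! Up to sign a unit tangent vector of `ℍ` is a matrix `g` (its frame), so `T¹S` is a quotient of
`SL(2, ℝ)` and the geodesic flow is right multiplication by `diag(e^(t/2), e^(-t/2))`. The geodesic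
of `g` runs from `g • 0` to `g • ∞`; lower unipotents on the right keep the backward endpoint, upper
ones the forward endpoint.

Recurrence near `g` is read off from the matrices `M = g⁻¹γg` with `γ ∈ Γ`. If `M 0 0` tends to
infinity and dominates the off-diagonal entries, the lower-diagonal-upper decomposition of `M` shows
that `g` is nonwandering (`mem_nonwanderingSet_of_tendsto`). Conversely a nonwandering `g` yields
such `M`; each is hyperbolic with eigenvectors near the coordinate axes, so periodic vectors are
dense in the nonwandering set (`exists_isAxisFrame_of_mem_nonwanderingSet`).

Given two hyperbolic axes, nonelementarity allows one to be translated so that no forbidden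
endpoints coincide. A geodesic leaving along the first axis and arriving along the second is then
nonwandering, by means of the products `γ₂ⁿγ₁ⁿ` (`mem_nonwanderingSet_of_asymptotic`). Hence
nonwandering orbits join any two open sets meeting the nonwandering set, and Baire's theorem gives a
dense `Gδ` of dense forward orbits.

For the cusp, a geodesic from `γ⁻¹ξ` to the parabolic point `ξ` is nonwandering, so nonwandering
vectors occur arbitrarily high in the cusp. A dense orbit comes close to them and crosses short
closed horocycles. It cannot leave every compact set: a periodic vector, being in its closure, would
lie on it, and the orbit would be periodic. -/

/-! ### One-parameter subgroups of `SL(2, ℝ)` -/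

/-- The diagonal matrix with entries `a, a⁻¹`. -/
noncomputable def diagSL : ℝˣ →* SL(2, ℝ) where
  toFun a := ⟨!![(a : ℝ), 0; 0, ((a⁻¹ : ℝˣ) : ℝ)], by simp [Matrix.det_fin_two_of]⟩
  map_one' := by ext i j; fin_cases i <;> fin_cases j <;> simp
  map_mul' a b := by
    refine Subtype.ext ?_
    change !![_, _; _, _] = !![_, _; _, _] * !![_, _; _, _]
    simp [mul_comm]

/-- The upper unipotent matrix with entry `x`. -/
def upperSL (x : ℝ) : SL(2, ℝ) := ⟨!![1, x; 0, 1], by simp [Matrix.det_fin_two_of]⟩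

/-- The lower unipotent matrix with entry `x`. -/
def lowerSL (x : ℝ) : SL(2, ℝ) := ⟨!![1, 0; x, 1], by simp [Matrix.det_fin_two_of]⟩

@[simp] theorem diagSL_00 (a : ℝˣ) : diagSL a 0 0 = a := rfl
@[simp] theorem diagSL_01 (a : ℝˣ) : diagSL a 0 1 = 0 := rfl
@[simp] theorem diagSL_10 (a : ℝˣ) : diagSL a 1 0 = 0 := rfl
@[simp] theorem diagSL_11 (a : ℝˣ) : diagSL a 1 1 = (a : ℝ)⁻¹ :=
  Units.val_inv_eq_inv_val a
@[simp] theorem upperSL_00 (x : ℝ) : upperSL x 0 0 = 1 := rfl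
@[simp] theorem upperSL_01 (x : ℝ) : upperSL x 0 1 = x := rfl
@[simp] theorem upperSL_10 (x : ℝ) : upperSL x 1 0 = 0 := rfl
@[simp] theorem upperSL_11 (x : ℝ) : upperSL x 1 1 = 1 := rfl
@[simp] theorem lowerSL_00 (x : ℝ) : lowerSL x 0 0 = 1 := rfl
@[simp] theorem lowerSL_01 (x : ℝ) : lowerSL x 0 1 = 0 := rfl
@[simp] theorem lowerSL_10 (x : ℝ) : lowerSL x 1 0 = x := rfl
@[simp] theorem lowerSL_11 (x : ℝ) : lowerSL x 1 1 = 1 := rfl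

theorem sl_ext {g h : SL(2, ℝ)} (h₀₀ : g 0 0 = h 0 0) (h₀₁ : g 0 1 = h 0 1) (h₁₀ : g 1 0 = h 1 0)
    (h₁₁ : g 1 1 = h 1 1) : g = h := by
  ext i j
  fin_cases i <;> fin_cases j <;> assumption

theorem sl_mul_apply (g h : SL(2, ℝ)) (i j : Fin 2) :
    (g * h) i j = g i 0 * h 0 j + g i 1 * h 1 j := by
  rw [Matrix.SpecialLinearGroup.coe_mul, Matrix.mul_apply, Fin.sum_univ_two]

theorem sl_det (g : SL(2, ℝ)) : g 0 0 * g 1 1 - g 0 1 * g 1 0 = 1 := by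
  rw [← Matrix.det_fin_two, g.det_coe]

theorem sl_neg_apply (g : SL(2, ℝ)) (i j : Fin 2) : (-g) i j = -(g i j) := by
  rw [Matrix.SpecialLinearGroup.coe_neg]; rfl

theorem sl_inv_00 (g : SL(2, ℝ)) : g⁻¹ 0 0 = g 1 1 := by
  simp [Matrix.SpecialLinearGroup.coe_inv, Matrix.adjugate_fin_two]
theorem sl_inv_01 (g : SL(2, ℝ)) : g⁻¹ 0 1 = -g 0 1 := by
  simp [Matrix.SpecialLinearGroup.coe_inv, Matrix.adjugate_fin_two]
theorem sl_inv_10 (g : SL(2, ℝ)) : g⁻¹ 1 0 = -g 1 0 := by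
  simp [Matrix.SpecialLinearGroup.coe_inv, Matrix.adjugate_fin_two]
theorem sl_inv_11 (g : SL(2, ℝ)) : g⁻¹ 1 1 = g 0 0 := by
  simp [Matrix.SpecialLinearGroup.coe_inv, Matrix.adjugate_fin_two]

theorem upperSL_add (x y : ℝ) : upperSL (x + y) = upperSL x * upperSL y := by
  apply sl_ext <;> simp [sl_mul_apply, add_comm]

theorem upperSL_pow (x : ℝ) (n : ℕ) : upperSL x ^ n = upperSL (n * x) := by
  induction n with
  | zero => apply sl_ext <;> simp
  | succ n ih => rw [pow_succ, ih, ← upperSL_add]; push_cast; ring_nf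

theorem upperSL_inv (x : ℝ) : (upperSL x)⁻¹ = upperSL (-x) := by
  apply sl_ext <;> simp [sl_inv_00, sl_inv_01, sl_inv_10, sl_inv_11]

theorem lowerSL_inv (x : ℝ) : (lowerSL x)⁻¹ = lowerSL (-x) := by
  apply sl_ext <;> simp [sl_inv_00, sl_inv_01, sl_inv_10, sl_inv_11]

theorem continuous_sl_of {X : Type*} [TopologicalSpace X] {f : X → SL(2, ℝ)}
    (h : ∀ i j, Continuous fun x ↦ f x i j) : Continuous f :=
  continuous_induced_rng.mpr (continuous_matrix h)

theorem continuous_sl_apply (i j : Fin 2) : Continuous fun g : SL(2, ℝ) ↦ g i j :=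
  continuous_subtype_val.matrix_elem i j

theorem continuous_upperSL : Continuous upperSL :=
  continuous_sl_of fun i j ↦ by fin_cases i <;> fin_cases j <;> simp <;> fun_prop

theorem continuous_lowerSL : Continuous lowerSL :=
  continuous_sl_of fun i j ↦ by fin_cases i <;> fin_cases j <;> simp <;> fun_prop

theorem upperSL_zero : upperSL 0 = 1 := by apply sl_ext <;> simp

theorem lowerSL_zero : lowerSL 0 = 1 := by apply sl_ext <;> simp

instance : LocallyCompactSpace SL(2, ℝ) :=
  haveI : LocallyCompactSpace (Matrix (Fin 2) (Fin 2) ℝ) :=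
    inferInstanceAs (LocallyCompactSpace (Fin 2 → Fin 2 → ℝ))
  Matrix.SpecialLinearGroup.isClosedEmbedding_val.locallyCompactSpace

instance : SecondCountableTopology SL(2, ℝ) :=
  haveI : SecondCountableTopology (Matrix (Fin 2) (Fin 2) ℝ) :=
    inferInstanceAs (SecondCountableTopology (Fin 2 → Fin 2 → ℝ))
  (Matrix.SpecialLinearGroup.isClosedEmbedding_val (n := Fin 2)
    (R := ℝ)).isEmbedding.isInducing.secondCountableTopology

/-! ### The unit tangent bundle as a homogeneous space -/

theorem UnitTangent.isClosedEmbedding_val :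
    Topology.IsClosedEmbedding (Subtype.val : {q : ℍ × ℂ // ‖q.2‖ = q.1.im} → ℍ × ℂ) := by
  refine (IsClosed.isClosedEmbedding_subtypeVal ?_)
  exact isClosed_eq (by fun_prop) (UpperHalfPlane.continuous_im.comp continuous_fst)

instance : LocallyCompactSpace UnitTangent := UnitTangent.isClosedEmbedding_val.locallyCompactSpace

instance : T2Space UnitTangent :=
  inferInstanceAs (T2Space {q : ℍ × ℂ // ‖q.2‖ = q.1.im})

theorem continuous_pt : Continuous UnitTangent.pt :=
  continuous_fst.comp (continuous_subtype_val (p := fun q : ℍ × ℂ ↦ ‖q.2‖ = q.1.im))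

theorem continuous_vec : Continuous UnitTangent.vec :=
  continuous_snd.comp (continuous_subtype_val (p := fun q : ℍ × ℂ ↦ ‖q.2‖ = q.1.im))

theorem continuous_den : Continuous fun q : SL(2, ℝ) × ℍ ↦ den q.1 q.2 := by
  have h (i j : Fin 2) : Continuous fun q : SL(2, ℝ) × ℍ ↦ ((q.1 i j : ℝ) : ℂ) :=
    Complex.continuous_ofReal.comp ((continuous_sl_apply i j).comp continuous_fst)
  exact ((h 1 0).mul (UpperHalfPlane.continuous_coe.comp continuous_snd)).add (h 1 1)

instance : ContinuousSMul SL(2, ℝ) UnitTangent where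
  continuous_smul := by
    have h1 : Continuous fun q : SL(2, ℝ) × UnitTangent ↦ (q.1, q.2.pt) :=
      continuous_fst.prodMk (continuous_pt.comp continuous_snd)
    refine continuous_induced_rng.mpr (Continuous.prodMk (continuous_smul.comp h1) ?_)
    exact (continuous_vec.comp continuous_snd).div ((continuous_den.comp h1).pow 2)
      fun q ↦ pow_ne_zero 2 (den_ne_zero _ _)

instance : MulAction.IsPretransitive SL(2, ℝ) UnitTangent where
  exists_smul_eq v w := by
    obtain ⟨g, rfl⟩ := exists_smul_vertical v
    obtain ⟨h, rfl⟩ := exists_smul_vertical w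
    exact ⟨h * g⁻¹, by rw [mul_smul, inv_smul_smul]⟩

/-- Openness is the open mapping theorem for a transitive continuous action of a σ-compact group on
a locally compact Hausdorff space. -/
theorem isOpenQuotientMap_smul_vertical :
    IsOpenQuotientMap fun g : SL(2, ℝ) ↦ g • vertical 0 where
  surjective := exists_smul_vertical
  continuous := by fun_prop
  isOpenMap := isOpenMap_smul_of_sigmaCompact _

theorem diagSL_smul_I (a : ℝˣ) :
    ((diagSL a • UpperHalfPlane.I : ℍ) : ℂ) = (a : ℂ) ^ 2 * Complex.I := by
  rw [UpperHalfPlane.coe_specialLinearGroup_apply]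
  have : ((a : ℝ) : ℂ) ≠ 0 := by exact_mod_cast a.ne_zero
  simp; field_simp

/-- The unit `e^(t/2)`; right multiplication by the corresponding diagonal matrix is the geodesic
flow at time `t`. -/
noncomputable def expHalf (t : ℝ) : ℝˣ := Units.mk0 (Real.exp (t / 2)) (Real.exp_ne_zero _)

theorem diagSL_smul_vertical_zero (t : ℝ) : diagSL (expHalf t) • vertical 0 = vertical t := by
  have h : (Real.exp (t / 2) : ℂ) ^ 2 = Real.exp t := by
    rw [← Complex.ofReal_pow, ← Real.exp_nat_mul]; congr 2; push_cast; ring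
  refine UnitTangent.ext ?_ ?_
  · rw [pt_smul, pt_vertical_zero]
    apply UpperHalfPlane.ext
    rw [diagSL_smul_I]
    change (Real.exp (t / 2) : ℂ) ^ 2 * Complex.I = Complex.I * Real.exp t
    rw [h, mul_comm]
  · rw [vec_smul, pt_vertical_zero, vec_vertical_zero]
    change _ = Complex.I * Real.exp t
    rw [← h]
    have := Complex.ofReal_ne_zero.mpr (Real.exp_ne_zero (t / 2))
    simp only [den, diagSL_10, diagSL_11, expHalf, Units.val_mk0]
    push_cast
    simp

/-! ### Frames of unit tangent vectors of the surface -/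

variable (Γ : Subgroup SL(2, ℝ))

/-- The unit tangent vector of the surface with frame `g`. -/
noncomputable def ofFrame (g : SL(2, ℝ)) : SurfaceUnitTangent Γ :=
  Quotient.mk (MulAction.orbitRel Γ UnitTangent) (g • vertical 0)

theorem isOpenQuotientMap_ofFrame : IsOpenQuotientMap (ofFrame Γ) :=
  (MulAction.isOpenQuotientMap_quotientMk (Γ := Γ) (T := UnitTangent)).comp
    isOpenQuotientMap_smul_vertical

theorem continuous_ofFrame : Continuous (ofFrame Γ) := (isOpenQuotientMap_ofFrame Γ).continuous

variable {Γ}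

theorem smul_vertical_zero_eq_iff {g h : SL(2, ℝ)} :
    g • vertical 0 = h • vertical 0 ↔ g = h ∨ g = -h := by
  constructor
  · intro e
    have := eq_one_or_neg_one (g := h⁻¹ * g) (by rw [mul_smul, e, inv_smul_smul])
    rcases this with e | e
    · exact Or.inl (inv_mul_eq_one.mp e).symm
    · right; rw [inv_mul_eq_iff_eq_mul] at e; simpa using e
  · rintro (rfl | rfl)
    · rfl
    · rw [← neg_one_mul, mul_smul, neg_one_smul]

/-- The sign appears because `Γ` need not contain `-1`. -/
theorem ofFrame_eq_iff {g h : SL(2, ℝ)} :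
    ofFrame Γ g = ofFrame Γ h ↔ ∃ γ ∈ Γ, γ * h = g ∨ γ * h = -g := by
  refine (Quotient.eq (r := MulAction.orbitRel Γ UnitTangent)).trans ?_
  rw [MulAction.orbitRel_apply, MulAction.mem_orbit_iff]
  constructor
  · rintro ⟨γ, e⟩
    refine ⟨γ, γ.2, smul_vertical_zero_eq_iff.mp ?_⟩
    rw [mul_smul]; exact e
  · rintro ⟨γ, hγ, e⟩
    refine ⟨⟨γ, hγ⟩, ?_⟩
    have := smul_vertical_zero_eq_iff.mpr e
    rwa [mul_smul] at this

theorem ofFrame_mul {γ : SL(2, ℝ)} (hγ : γ ∈ Γ) (g : SL(2, ℝ)) :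
    ofFrame Γ (γ * g) = ofFrame Γ g := ofFrame_eq_iff.mpr ⟨γ, hγ, Or.inl rfl⟩

theorem ofFrame_neg (g : SL(2, ℝ)) : ofFrame Γ (-g) = ofFrame Γ g :=
  ofFrame_eq_iff.mpr ⟨1, Γ.one_mem, Or.inr (by simp)⟩

theorem geodesicFlow_ofFrame (t : ℝ) (g : SL(2, ℝ)) :
    geodesicFlow Γ t (ofFrame Γ g) = ofFrame Γ (g * diagSL (expHalf t)) := by
  change Quotient.mk (MulAction.orbitRel Γ UnitTangent) (flow t (g • vertical 0)) = _
  rw [flow_smul_vertical, ← diagSL_smul_vertical_zero, ← mul_smul]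
  rfl

/-- Negative `a` are allowed since hyperbolic elements of `Γ` may have negative trace; the sign is
lost in `T¹S`. -/
theorem ofFrame_mul_diagSL (g : SL(2, ℝ)) (a : ℝˣ) :
    ofFrame Γ (g * diagSL a) = geodesicFlow Γ (2 * Real.log |(a : ℝ)|) (ofFrame Γ g) := by
  rw [geodesicFlow_ofFrame]
  have h : (expHalf (2 * Real.log |(a : ℝ)|) : ℝ) = |(a : ℝ)| := by
    simp [expHalf, Real.exp_log_eq_abs a.ne_zero]
  rcases abs_choice (a : ℝ) with e | e <;> rw [e] at h
  · rw [e, Units.ext h]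
  · have : expHalf (2 * Real.log |(a : ℝ)|) = -a := Units.ext (by rw [e, h]; simp)
    rw [this]
    have : diagSL (-a) = - diagSL a := by
      apply sl_ext <;> simp [sl_neg_apply, -neg_mul]
    rw [this, mul_neg, ofFrame_neg]

theorem expHalf_add (s t : ℝ) : expHalf (s + t) = expHalf s * expHalf t :=
  Units.ext (by simp [expHalf, add_div, Real.exp_add])

theorem geodesicFlow_add (s t : ℝ) (x : SurfaceUnitTangent Γ) :
    geodesicFlow Γ (s + t) x = geodesicFlow Γ s (geodesicFlow Γ t x) := by
  obtain ⟨g, rfl⟩ := (isOpenQuotientMap_ofFrame Γ).surjective x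
  simp only [geodesicFlow_ofFrame, mul_assoc, ← map_mul, ← expHalf_add]
  rw [add_comm]

theorem continuous_diagSL_expHalf : Continuous fun t ↦ diagSL (expHalf t) := by
  refine continuous_sl_of fun i j ↦ ?_
  fin_cases i <;> fin_cases j <;> simp [expHalf, ← Real.exp_neg] <;> fun_prop

theorem continuous_geodesicFlow (t : ℝ) : Continuous (geodesicFlow Γ t) := by
  rw [← (isOpenQuotientMap_ofFrame Γ).continuous_comp_iff]
  have : geodesicFlow Γ t ∘ ofFrame Γ = fun g ↦ ofFrame Γ (g * diagSL (expHalf t)) :=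
    funext fun g ↦ geodesicFlow_ofFrame t g
  rw [this]
  exact (continuous_ofFrame Γ).comp (continuous_mul_const _)

theorem continuous_geodesicFlow_left (x : SurfaceUnitTangent Γ) :
    Continuous fun t ↦ geodesicFlow Γ t x := by
  obtain ⟨g, rfl⟩ := (isOpenQuotientMap_ofFrame Γ).surjective x
  simp only [geodesicFlow_ofFrame]
  exact (continuous_ofFrame Γ).comp (continuous_diagSL_expHalf.const_mul g)

instance : SecondCountableTopology (SurfaceUnitTangent Γ) :=
  (isOpenQuotientMap_ofFrame Γ).isQuotientMap.secondCountableTopology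
    (isOpenQuotientMap_ofFrame Γ).isOpenMap

theorem isClosed_of_discreteTopology (hΓ : DiscreteTopology Γ) :
    IsClosed (Γ : Set SL(2, ℝ)) := by
  let _ := IsTopologicalGroup.rightUniformSpace SL(2, ℝ)
  infer_instance

theorem t2Space_surfaceUnitTangent (hΓ : DiscreteTopology Γ) : T2Space (SurfaceUnitTangent Γ) := by
  rw [t2Space_iff_of_isOpenQuotientMap (isOpenQuotientMap_ofFrame Γ)]
  have : {q : SL(2, ℝ) × SL(2, ℝ) | ofFrame Γ q.1 = ofFrame Γ q.2} =
      (fun q ↦ q.1 * q.2⁻¹) ⁻¹' Γ ∪ (fun q ↦ -(q.1 * q.2⁻¹)) ⁻¹' Γ := by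
    ext ⟨g, h⟩
    simp only [Set.mem_ofPred_eq, ofFrame_eq_iff, Set.mem_union, Set.mem_preimage, SetLike.mem_coe]
    constructor
    · rintro ⟨γ, hγ, e | e⟩
      · left; rwa [← e, mul_inv_cancel_right]
      · right; rwa [← neg_mul, ← e, mul_inv_cancel_right]
    · rintro (e | e)
      · exact ⟨_, e, Or.inl (by simp)⟩
      · exact ⟨_, e, Or.inr (by simp)⟩
  rw [this]
  have hc := isClosed_of_discreteTopology hΓ
  have h1 : Continuous fun q : SL(2, ℝ) × SL(2, ℝ) ↦ q.1 * q.2⁻¹ := by fun_prop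
  have h2 : Continuous fun q : SL(2, ℝ) × SL(2, ℝ) ↦ -(q.1 * q.2⁻¹) := by
    refine continuous_sl_of fun i j ↦ ?_
    simp only [sl_neg_apply]
    exact ((continuous_sl_apply i j).comp h1).neg
  exact (hc.preimage h1).union (hc.preimage h2)

/-! ### The nonwandering set -/

theorem isClosed_nonwanderingSet {X : Type*} [TopologicalSpace X] (φ : ℝ → X → X) :
    IsClosed (nonwanderingSet φ) := by
  rw [← isOpen_compl_iff, isOpen_iff_mem_nhds]
  intro x hx
  have hx' : ¬ ∀ U ∈ 𝓝 x, ∀ T : ℝ, ∃ t ≥ T, (φ t '' U ∩ U).Nonempty := hx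
  push Not at hx'
  obtain ⟨U, hU, T, hT⟩ := hx'
  obtain ⟨V, hVU, hV, hxV⟩ := mem_nhds_iff.mp hU
  filter_upwards [hV.mem_nhds hxV] with y hy hyN
  obtain ⟨t, ht, z, ⟨w, hw, e⟩, hz⟩ := hyN V (hV.mem_nhds hy) T
  have : z ∈ φ t '' U ∩ U := ⟨⟨w, hVU hw, e⟩, hVU hz⟩
  rw [hT t ht] at this
  exact this

/-- The decomposition of a matrix with nonzero upper left entry into a lower unipotent, a diagonal
and an upper unipotent matrix. -/
theorem eq_lower_mul_diag_mul_upper (M : SL(2, ℝ)) (a : ℝˣ) (ha : (a : ℝ) = M 0 0) :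
    M = lowerSL (M 1 0 / M 0 0) * diagSL a * upperSL (M 0 1 / M 0 0) := by
  have h0 : M 0 0 ≠ 0 := ha ▸ a.ne_zero
  have hd := sl_det M
  apply sl_ext <;> simp [sl_mul_apply, ha] <;> field_simp
  linarith

/-- By the decomposition of `M n`, the element `g * M n * g⁻¹` takes `g * upperSL (-M01/M00)` to `g
* lowerSL (M10/M00) * diag(M00)`. So in the quotient a vector near `g`, flowed for the large time `2
log |M00|`, is again near `g`. -/
theorem mem_nonwanderingSet_of_tendsto {g : SL(2, ℝ)} (M : ℕ → SL(2, ℝ))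
    (hM : ∀ n, g * M n * g⁻¹ ∈ Γ) (h₀₀ : Tendsto (fun n ↦ |M n 0 0|) atTop atTop)
    (h₀₁ : Tendsto (fun n ↦ M n 0 1 / M n 0 0) atTop (𝓝 0))
    (h₁₀ : Tendsto (fun n ↦ M n 1 0 / M n 0 0) atTop (𝓝 0)) :
    ofFrame Γ g ∈ nonwanderingSet (geodesicFlow Γ) := by
  intro U hU T
  have hL : Tendsto (fun n ↦ ofFrame Γ (g * lowerSL (M n 1 0 / M n 0 0))) atTop
      (𝓝 (ofFrame Γ g)) := by
    have : Continuous fun x ↦ ofFrame Γ (g * lowerSL x) :=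
      (continuous_ofFrame Γ).comp (continuous_lowerSL.const_mul g)
    have := (this.tendsto 0).comp h₁₀
    rwa [lowerSL_zero, mul_one] at this
  have hR : Tendsto (fun n ↦ ofFrame Γ (g * upperSL (-(M n 0 1 / M n 0 0)))) atTop
      (𝓝 (ofFrame Γ g)) := by
    have : Continuous fun x ↦ ofFrame Γ (g * upperSL (-x)) :=
      (continuous_ofFrame Γ).comp ((continuous_upperSL.comp continuous_neg).const_mul g)
    have := (this.tendsto 0).comp h₀₁
    rwa [neg_zero, upperSL_zero, mul_one] at this
  have hT : ∀ᶠ n in atTop, T ≤ 2 * Real.log |M n 0 0| :=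
    ((Real.tendsto_log_atTop.comp h₀₀).const_mul_atTop two_pos).eventually_ge_atTop T
  obtain ⟨n, h1, h2, h3, h4⟩ := (hL.eventually_mem hU |>.and <| hR.eventually_mem hU |>.and <|
    hT.and <| h₀₀.eventually_gt_atTop 0).exists
  set a : ℝˣ := Units.mk0 (M n 0 0) (abs_pos.mp h4)
  refine ⟨_, h3, _, ⟨_, h1, rfl⟩, ?_⟩
  rw [show M n 0 0 = (a : ℝ) from rfl, ← ofFrame_mul_diagSL]
  have e : g * M n * g⁻¹ * (g * upperSL (-(M n 0 1 / M n 0 0))) =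
      g * lowerSL (M n 1 0 / M n 0 0) * diagSL a := by
    have := eq_lower_mul_diag_mul_upper (M n) a rfl
    rw [← upperSL_inv]
    rw [mul_assoc g (lowerSL _), eq_mul_inv_iff_mul_eq.mpr this.symm]
    group
  have h5 := (ofFrame_mul (hM n) _).symm.trans (congrArg (ofFrame Γ) e)
  exact h5 ▸ h2

/-! ### Frames of periodic vectors -/

/-- The vector with frame `g` is tangent to the axis of a hyperbolic element of `Γ`, in the
direction of the attracting fixed point. -/
def IsAxisFrame (Γ : Subgroup SL(2, ℝ)) (g : SL(2, ℝ)) : Prop :=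
  ∃ a : ℝˣ, 1 < |(a : ℝ)| ∧ g * diagSL a * g⁻¹ ∈ Γ

theorem conj_diagSL_pow_mem {g : SL(2, ℝ)} {a : ℝˣ} (h : g * diagSL a * g⁻¹ ∈ Γ) (n : ℕ) :
    g * diagSL (a ^ n) * g⁻¹ ∈ Γ := by
  rw [map_pow, ← conj_pow]; exact pow_mem h n

theorem IsAxisFrame.mem_nonwanderingSet {g : SL(2, ℝ)} (h : IsAxisFrame Γ g) :
    ofFrame Γ g ∈ nonwanderingSet (geodesicFlow Γ) := by
  obtain ⟨a, ha, hg⟩ := h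
  refine mem_nonwanderingSet_of_tendsto (fun n ↦ diagSL (a ^ n))
    (fun n ↦ conj_diagSL_pow_mem hg n) ?_ ?_ ?_
  · simpa only [diagSL_00, Units.val_pow_eq_pow_val, abs_pow] using
      tendsto_pow_atTop_atTop_of_one_lt ha
  · simp only [diagSL_01, zero_div, tendsto_const_nhds]
  · simp only [diagSL_10, zero_div, tendsto_const_nhds]

theorem IsAxisFrame.geodesicFlow_periodic {g : SL(2, ℝ)} (h : IsAxisFrame Γ g) :
    ∃ T > 0, ∀ n : ℕ, geodesicFlow Γ (n * T) (ofFrame Γ g) = ofFrame Γ g := by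
  obtain ⟨a, ha, hg⟩ := h
  refine ⟨2 * Real.log |(a : ℝ)|, by have := Real.log_pos ha; positivity, fun n ↦ ?_⟩
  have := ofFrame_mul_diagSL (Γ := Γ) g (a ^ n)
  rw [Units.val_pow_eq_pow_val, abs_pow, Real.log_pow] at this
  rw [show (n : ℝ) * (2 * Real.log |(a : ℝ)|) = 2 * (n * Real.log |(a : ℝ)|) by ring, ← this,
    ← ofFrame_mul (conj_diagSL_pow_mem hg n) g]
  simp

/-! ### The closing lemma: periodic vectors near nonwandering ones. -/

/-- A quadratic polynomial with dominant linear coefficient has a small root. -/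
theorem exists_small_root {a b c δ : ℝ} (hδ : 0 < δ) (h : |a| * δ ^ 2 + |c| ≤ |b| * δ) :
    ∃ p, |p| ≤ δ ∧ a * p ^ 2 + b * p + c = 0 := by
  -- The linear term outweighs the others at `±δ`, so the values there have opposite signs.
  have key : (a * (-δ) ^ 2 + b * (-δ) + c ≤ 0 ∧ 0 ≤ a * δ ^ 2 + b * δ + c) ∨
      (a * δ ^ 2 + b * δ + c ≤ 0 ∧ 0 ≤ a * (-δ) ^ 2 + b * (-δ) + c) := by
    have h1 : |a * δ ^ 2 + c| ≤ |b| * δ := by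
      refine (abs_add_le _ _).trans ?_
      rwa [abs_mul, abs_of_nonneg (sq_nonneg δ)]
    have h2 := abs_le.mp h1
    rcases abs_choice b with e | e <;> rw [e] at h2
    · left; constructor <;> nlinarith
    · right; constructor <;> nlinarith
  have hc : Continuous fun p : ℝ ↦ a * p ^ 2 + b * p + c := by fun_prop
  have hle : -δ ≤ δ := by linarith
  rcases key with ⟨h1, h2⟩ | ⟨h1, h2⟩
  · obtain ⟨p, hp, e⟩ := intermediate_value_Icc hle hc.continuousOn (Set.mem_Icc.mpr ⟨h1, h2⟩)
    exact ⟨p, abs_le.mpr hp, e⟩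
  · obtain ⟨p, hp, e⟩ := intermediate_value_Icc' hle hc.continuousOn (Set.mem_Icc.mpr ⟨h1, h2⟩)
    exact ⟨p, abs_le.mpr hp, e⟩

theorem geodesicFlow_mem_nonwanderingSet {x : SurfaceUnitTangent Γ}
    (hx : x ∈ nonwanderingSet (geodesicFlow Γ)) (s : ℝ) :
    geodesicFlow Γ s x ∈ nonwanderingSet (geodesicFlow Γ) := by
  intro U hU T
  obtain ⟨t, ht, _, ⟨y, hy, rfl⟩, hy'⟩ :=
    hx _ ((continuous_geodesicFlow s).continuousAt.preimage_mem_nhds hU) T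
  refine ⟨t, ht, _, ⟨_, hy, rfl⟩, ?_⟩
  rw [← geodesicFlow_add, add_comm, geodesicFlow_add]
  exact hy'

/-- A return from `g * k` to `g * k'` with `k`, `k'` near `1` gives, up to sign, `M = k *
diag(e^(t/2), e^(-t/2)) * k'⁻¹`, which is close to `e^(t/2)` times the matrix unit `E₀₀`. -/
theorem exists_conj_mem_of_mem_nonwanderingSet {g : SL(2, ℝ)}
    (hg : ofFrame Γ g ∈ nonwanderingSet (geodesicFlow Γ)) {ε : ℝ} (hε : 0 < ε) :
    ∃ M : SL(2, ℝ), g * M * g⁻¹ ∈ Γ ∧ 1 / ε < |M 0 0| ∧ |M 0 1| ≤ ε * |M 0 0| ∧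
      |M 1 0| ≤ ε * |M 0 0| := by
  -- Entries of `k * diag * k'⁻¹` with `e^(t/2)` factored out, as functions of `(k, e^(-t), k'⁻¹)`.
  -- They are continuous up to `e^(-t) = 0`, so large `t` becomes a neighbourhood condition at `(1,
  -- 0, 1)`.
  let F (i j : Fin 2) (q : SL(2, ℝ) × ℝ × SL(2, ℝ)) : ℝ :=
    q.1 i 0 * q.2.2 0 j + q.2.1 * (q.1 i 1 * q.2.2 1 j)
  have hF (i j : Fin 2) : Continuous (F i j) := by
    have h1 (i j : Fin 2) : Continuous fun q : SL(2, ℝ) × ℝ × SL(2, ℝ) ↦ q.1 i j :=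
      (continuous_sl_apply i j).comp continuous_fst
    have h2 (i j : Fin 2) : Continuous fun q : SL(2, ℝ) × ℝ × SL(2, ℝ) ↦ q.2.2 i j :=
      (continuous_sl_apply i j).comp (continuous_snd.comp continuous_snd)
    exact ((h1 _ _).mul (h2 _ _)).add
      ((continuous_fst.comp continuous_snd).mul ((h1 _ _).mul (h2 _ _)))
  have hev : ∀ᶠ q in 𝓝 ((1, 0, 1) : SL(2, ℝ) × ℝ × SL(2, ℝ)),
      1 / 2 < F 0 0 q ∧ |F 0 1 q| < ε / 2 ∧ |F 1 0 q| < ε / 2 := by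
    refine ((hF 0 0).tendsto _ |>.eventually_const_lt ?_).and
      (((hF 0 1).abs.tendsto _ |>.eventually_lt_const ?_).and
        ((hF 1 0).abs.tendsto _ |>.eventually_lt_const ?_)) <;> norm_num [F, hε]
  rw [nhds_prod_eq, nhds_prod_eq] at hev
  obtain ⟨W₁, hW₁, S, hS, hWS⟩ := mem_prod_iff.mp hev
  obtain ⟨I, hI, W₂, hW₂, hIW⟩ := mem_prod_iff.mp hS
  have hW : W₁ ∩ W₂⁻¹ ∈ 𝓝 (1 : SL(2, ℝ)) := inter_mem hW₁ (inv_mem_nhds_one _ hW₂)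
  have hU : ofFrame Γ '' ((fun k ↦ g * k) '' (W₁ ∩ W₂⁻¹)) ∈ 𝓝 (ofFrame Γ g) := by
    refine (isOpenQuotientMap_ofFrame Γ).isOpenMap.image_mem_nhds ?_
    simpa using (isOpenMap_mul_left g).image_mem_nhds hW
  have hexp : Tendsto (fun t : ℝ ↦ Real.exp (-t)) atTop (𝓝 0) := Real.tendsto_exp_neg_atTop_nhds_zero
  have hexp' : Tendsto (fun t : ℝ ↦ Real.exp (t / 2)) atTop atTop :=
    Real.tendsto_exp_atTop.comp (tendsto_id.atTop_div_const two_pos)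
  obtain ⟨T, hT⟩ := eventually_atTop.mp
    ((hexp.eventually_mem hI).and (hexp'.eventually_gt_atTop (2 / ε)))
  obtain ⟨t, ht, _, ⟨_, ⟨_, ⟨k, hk, rfl⟩, rfl⟩, rfl⟩, ⟨_, ⟨k', hk', rfl⟩, e⟩⟩ := hg _ hU T
  obtain ⟨hI', hlarge⟩ := hT t ht
  have hq := hWS (Set.mk_mem_prod hk.1 (hIW (Set.mk_mem_prod hI' hk'.2)))
  obtain ⟨f00, f01, f10⟩ := hq
  have hM (i j : Fin 2) : (k * diagSL (expHalf t) * k'⁻¹) i j =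
      Real.exp (t / 2) * F i j (k, Real.exp (-t), k'⁻¹) := by
    have : (Real.exp (t / 2))⁻¹ = Real.exp (t / 2) * Real.exp (-t) := by
      rw [← Real.exp_neg, ← Real.exp_add]; congr 1; ring
    simp only [sl_mul_apply, diagSL_00, diagSL_01, diagSL_10, diagSL_11, F, expHalf, Units.val_mk0,
      this]
    ring
  have hpos := Real.exp_pos (t / 2)
  have habs (i j : Fin 2) : |(k * diagSL (expHalf t) * k'⁻¹) i j| =
      Real.exp (t / 2) * |F i j (k, Real.exp (-t), k'⁻¹)| := by
    rw [hM, abs_mul, abs_of_pos hpos]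
  have hbd : 1 / ε < |(k * diagSL (expHalf t) * k'⁻¹) 0 0| ∧
      |(k * diagSL (expHalf t) * k'⁻¹) 0 1| ≤ ε * |(k * diagSL (expHalf t) * k'⁻¹) 0 0| ∧
      |(k * diagSL (expHalf t) * k'⁻¹) 1 0| ≤ ε * |(k * diagSL (expHalf t) * k'⁻¹) 0 0| := by
    rw [habs, habs, habs]
    have h0 := f00.trans_le (le_abs_self _)
    have h2 : 2 / ε = 2 * (1 / ε) := by ring
    refine ⟨?_, ?_, ?_⟩
    · nlinarith
    · rw [mul_left_comm]
      exact mul_le_mul_of_nonneg_left (by nlinarith) hpos.le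
    · rw [mul_left_comm]
      exact mul_le_mul_of_nonneg_left (by nlinarith) hpos.le
  rw [geodesicFlow_ofFrame] at e
  obtain ⟨γ, hγ, e | e⟩ := ofFrame_eq_iff.mp e.symm
  · refine ⟨k * diagSL (expHalf t) * k'⁻¹, ?_, hbd⟩
    rw [eq_mul_inv_iff_mul_eq.mpr e] at hγ
    convert hγ using 1
    group
  · refine ⟨-(k * diagSL (expHalf t) * k'⁻¹), ?_, ?_⟩
    · rw [eq_mul_inv_iff_mul_eq.mpr e] at hγ
      convert hγ using 1
      simp only [neg_mul, mul_neg, mul_assoc, mul_inv_rev]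
    · simpa only [sl_neg_apply, abs_neg] using hbd

/-- A matrix with dominant upper left entry is hyperbolic, and it is diagonalized by a matrix close
to the identity. -/
theorem exists_conj_eq_diagSL {M : SL(2, ℝ)} {δ : ℝ} (hδ0 : 0 < δ) (hδ1 : δ ≤ 1 / 2)
    (ha : 1 / (δ / 4) < |M 0 0|) (hb : |M 0 1| ≤ δ / 4 * |M 0 0|)
    (hc : |M 1 0| ≤ δ / 4 * |M 0 0|) :
    ∃ (p q : ℝ) (a : ℝˣ), |p| ≤ δ ∧ |q| ≤ δ ∧ 1 < |(a : ℝ)| ∧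
      M * (lowerSL p * upperSL (q / (1 - p * q))) =
        lowerSL p * upperSL (q / (1 - p * q)) * diagSL a := by
  have hdet := sl_det M
  have ha0 : 8 < |M 0 0| := by
    refine lt_of_le_of_lt ?_ ha
    rw [le_div_iff₀ (by positivity)]; linarith
  have hδa : δ / 4 * |M 0 0| ≤ |M 0 0| / 8 := by
    have := mul_le_mul_of_nonneg_right hδ1 (abs_nonneg (M 0 0))
    linarith
  -- Determinant one bounds the remaining entry, which separates the two diagonal entries.
  have hd : |M 1 1| ≤ |M 0 0| / 4 := by
    have h1 : |M 0 0| * |M 1 1| ≤ 1 + |M 0 1| * |M 1 0| := by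
      rw [← abs_mul, ← abs_mul, show M 0 0 * M 1 1 = 1 + M 0 1 * M 1 0 by linarith]
      exact (abs_add_le _ _).trans (by simp)
    have h2 : |M 0 1| * |M 1 0| ≤ (|M 0 0| / 8) * (|M 0 0| / 8) :=
      mul_le_mul (hb.trans hδa) (hc.trans hδa) (abs_nonneg _) (by positivity)
    have h3 : 8 * 8 ≤ |M 0 0| * |M 0 0| := mul_self_le_mul_self (by norm_num) ha0.le
    refine le_of_mul_le_mul_left (a := |M 0 0|) ?_ (by linarith)
    linarith
  have had : |M 0 0| / 2 ≤ |M 0 0 - M 1 1| := by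
    have := abs_sub_abs_le_abs_sub (M 0 0) (M 1 1)
    linarith
  have hδ2 : δ ^ 2 ≤ 1 := pow_le_one₀ hδ0.le (by linarith)
  have had' : |M 0 0| / 2 * δ ≤ |M 0 0 - M 1 1| * δ := mul_le_mul_of_nonneg_right had hδ0.le
  -- The two quadratics say that `(1, p)` and `(q, 1)` are eigenvectors of `M`. They span the
  -- columns of the conjugating matrix, the second scaled by `1 / (1 - p * q)` to get determinant
  -- one. The eigenvalue of `(1, p)` is `M 0 0 + M 0 1 * p`.
  obtain ⟨p, hp, ep⟩ := exists_small_root (a := M 0 1) (b := M 0 0 - M 1 1) (c := -M 1 0) hδ0 (by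
    rw [abs_neg]
    linarith [mul_le_mul_of_nonneg_left hδ2 (abs_nonneg (M 0 1))])
  obtain ⟨q, hq, eq⟩ := exists_small_root (a := M 1 0) (b := M 1 1 - M 0 0) (c := -M 0 1) hδ0 (by
    rw [abs_neg, abs_sub_comm]
    linarith [mul_le_mul_of_nonneg_left hδ2 (abs_nonneg (M 1 0))])
  have hpq : 1 - p * q ≠ 0 := by
    have : |p * q| ≤ 1 / 2 * (1 / 2) := by
      rw [abs_mul]
      exact mul_le_mul (hp.trans hδ1) (hq.trans hδ1) (abs_nonneg _) (by norm_num)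
    have := (abs_le.mp this).2
    linarith
  have hlt : 1 < |M 0 0 + M 0 1 * p| := by
    have h1 : |M 0 1 * p| ≤ |M 0 0| / 8 * 1 := by
      rw [abs_mul]
      exact mul_le_mul (hb.trans hδa) (by linarith) (abs_nonneg _) (by positivity)
    have h2 := abs_sub_abs_le_abs_sub (M 0 0) (-(M 0 1 * p))
    rw [abs_neg, sub_neg_eq_add] at h2
    linarith
  have hne : M 0 0 + M 0 1 * p ≠ 0 := abs_pos.mp (by linarith)
  have hinv : (M 0 0 + M 0 1 * p)⁻¹ = M 1 1 - M 0 1 * p := by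
    refine inv_eq_of_mul_eq_one_right ?_
    linear_combination hdet - M 0 1 * ep
  refine ⟨p, q, Units.mk0 _ hne, hp, hq, hlt, ?_⟩
  have hcq : M 1 0 * q = -(M 0 1 * p) := by
    refine mul_right_cancel₀ hpq ?_
    linear_combination -q * ep - p * eq
  have hx : q / (1 - p * q) * (1 - p * q) = q := div_mul_cancel₀ _ hpq
  generalize q / (1 - p * q) = x at hx
  apply sl_ext <;> simp [sl_mul_apply, hinv]
  · refine mul_right_cancel₀ hpq ?_
    linear_combination (M 0 0 + 2 * M 0 1 * p - M 1 1) * hx - eq + q * hcq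
  · linear_combination -ep
  · refine mul_right_cancel₀ hpq ?_
    linear_combination (M 1 0 + M 0 1 * p ^ 2) * hx + hcq

/-- Periodic vectors are dense in the nonwandering set. -/
theorem exists_isAxisFrame_of_mem_nonwanderingSet {g : SL(2, ℝ)}
    (hg : ofFrame Γ g ∈ nonwanderingSet (geodesicFlow Γ)) {W : Set SL(2, ℝ)} (hW : W ∈ 𝓝 g) :
    ∃ h ∈ W, IsAxisFrame Γ h := by
  have hN : ∀ᶠ x : ℝ × ℝ in 𝓝 (0, 0),
      g * (lowerSL x.1 * upperSL (x.2 / (1 - x.1 * x.2))) ∈ W := by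
    have : ContinuousAt (fun x : ℝ × ℝ ↦ g * (lowerSL x.1 * upperSL (x.2 / (1 - x.1 * x.2))))
        (0, 0) := by
      refine continuousAt_const.mul ((continuous_lowerSL.comp continuous_fst).continuousAt.mul
        (continuous_upperSL.continuousAt.comp ?_))
      exact continuousAt_snd.div (by fun_prop) (by simp)
    refine this.eventually_mem ?_
    simpa [lowerSL_zero, upperSL_zero] using hW
  obtain ⟨r, hr, hrW⟩ := Metric.eventually_nhds_iff.mp hN
  have hδ0 : 0 < min (r / 2) (1 / 2) := by positivity
  have hδr : min (r / 2) (1 / 2) < r := (min_le_left _ _).trans_lt (by linarith)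
  obtain ⟨M, hM, ha, hb, hc⟩ := exists_conj_mem_of_mem_nonwanderingSet hg
    (show (0 : ℝ) < min (r / 2) (1 / 2) / 4 by positivity)
  obtain ⟨p, q, a, hp, hq, h1, e⟩ := exists_conj_eq_diagSL hδ0 (min_le_right _ _) ha hb hc
  refine ⟨_, hrW (y := (p, q)) ?_, a, h1, ?_⟩
  · rw [Prod.dist_eq]
    simpa using ⟨hp.trans_lt hδr, hq.trans_lt hδr⟩
  · convert hM using 1
    rw [mul_assoc g, ← e]
    group

/-! ### Topological transitivity -/

theorem toGL_smul_infty_eq_zero_iff (k : SL(2, ℝ)) :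
    (k : GL (Fin 2) ℝ) • (∞ : OnePoint ℝ) = ((0 : ℝ) : OnePoint ℝ) ↔ k 0 0 = 0 := by
  have hd := sl_det k
  rw [OnePoint.smul_infty_eq_ite]
  change (if k 1 0 = 0 then (∞ : OnePoint ℝ) else ((k 0 0 / k 1 0 : ℝ) : OnePoint ℝ)) = _ ↔ _
  split_ifs with h
  · simp only [OnePoint.infty_ne_coe, false_iff]
    intro h0
    simp [h, h0] at hd
  · rw [OnePoint.coe_eq_coe, div_eq_zero_iff]
    simp [h]

theorem toGL_smul_zero_eq_infty_iff (k : SL(2, ℝ)) :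
    (k : GL (Fin 2) ℝ) • ((0 : ℝ) : OnePoint ℝ) = ∞ ↔ k 1 1 = 0 := by
  rw [OnePoint.smul_some_eq_ite]
  simp

/-- The stabilizer in `Γ` of a boundary point. -/
noncomputable def boundaryStabilizer (Γ : Subgroup SL(2, ℝ)) (ξ : OnePoint ℝ) : Subgroup Γ :=
  (MulAction.stabilizer (GL (Fin 2) ℝ) ξ).comap
    (Matrix.SpecialLinearGroup.toGL.comp Γ.subtype)

theorem mem_boundaryStabilizer {ξ : OnePoint ℝ} {γ : Γ} :
    γ ∈ boundaryStabilizer Γ ξ ↔ ((γ : SL(2, ℝ)) : GL (Fin 2) ℝ) • ξ = ξ := Iff.rfl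

theorem IsNonelementary.not_finiteIndex_boundaryStabilizer (h : IsNonelementary Γ)
    (ξ : OnePoint ℝ) : ¬ (boundaryStabilizer Γ ξ).FiniteIndex := by
  intro hf
  let _ : MulAction Γ (OnePoint ℝ) :=
    MulAction.compHom _ (Matrix.SpecialLinearGroup.toGL.comp Γ.subtype)
  have hs : boundaryStabilizer Γ ξ = MulAction.stabilizer Γ ξ := rfl
  have h1 := hf.index_ne_zero
  rw [hs, MulAction.index_stabilizer] at h1
  refine h.2 ξ ?_
  convert Set.finite_of_ncard_ne_zero h1 using 1
  ext η
  simp only [Set.mem_ofPred_eq, MulAction.mem_orbit_iff, Subtype.exists]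
  exact ⟨fun ⟨γ, hγ, e⟩ ↦ ⟨γ, hγ, e⟩, fun ⟨γ, hγ, e⟩ ↦ ⟨γ, hγ, e⟩⟩

open scoped Pointwise in
/-- In a nonelementary group there is an element which does not map given boundary points
`ξ₁, ξ₂` to given boundary points `η₁, η₂`. -/
theorem IsNonelementary.exists_smul_ne (h : IsNonelementary Γ) (ξ η : Fin 2 → OnePoint ℝ) :
    ∃ γ ∈ Γ, ∀ i, (γ : GL (Fin 2) ℝ) • ξ i ≠ η i := by
  by_contra! hcon
  classical
  let g (i : Fin 2) : Γ := if H : ∃ γ : Γ, ((γ : SL(2, ℝ)) : GL (Fin 2) ℝ) • ξ i = η i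
    then H.choose else 1
  -- The elements taking `ξ i` to `η i` form at most one left coset of the stabilizer of `ξ i`. By
  -- B. H. Neumann's lemma, finitely many cosets of subgroups of infinite index cannot cover the
  -- group.
  have hcov : ⋃ i ∈ Finset.univ, g i • (boundaryStabilizer Γ (ξ i) : Set Γ) = Set.univ := by
    rw [Set.eq_univ_iff_forall]
    intro γ
    obtain ⟨i, hi⟩ := hcon γ γ.2
    have H : ∃ γ : Γ, ((γ : SL(2, ℝ)) : GL (Fin 2) ℝ) • ξ i = η i := ⟨γ, hi⟩
    have hg : ((g i : SL(2, ℝ)) : GL (Fin 2) ℝ) • ξ i = η i := by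
      simp only [g, dif_pos H]; exact H.choose_spec
    simp only [Set.mem_iUnion]
    refine ⟨i, Finset.mem_univ _, ?_⟩
    rw [mem_leftCoset_iff, SetLike.mem_coe, mem_boundaryStabilizer]
    push_cast
    rw [map_mul, map_inv, mul_smul, hi, ← hg, inv_smul_smul]
  obtain ⟨i, -, hi⟩ := Subgroup.exists_finiteIndex_of_leftCoset_cover hcov
  exact h.not_finiteIndex_boundaryStabilizer _ hi

/-- The entry `0 0` vanishes iff `γg₂∞ = g₁0`, the entry `1 1` iff `γg₂0 = g₁∞`. The first condition
makes the connecting geodesic exist, the second makes it nonwandering. -/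
theorem IsNonelementary.exists_conj_entries_ne_zero (h : IsNonelementary Γ) (g₁ g₂ : SL(2, ℝ)) :
    ∃ γ ∈ Γ, (g₁⁻¹ * (γ * g₂)) 0 0 ≠ 0 ∧ (g₁⁻¹ * (γ * g₂)) 1 1 ≠ 0 := by
  obtain ⟨γ, hγ, H⟩ := h.exists_smul_ne
    ![(g₂ : GL (Fin 2) ℝ) • (∞ : OnePoint ℝ), (g₂ : GL (Fin 2) ℝ) • ((0 : ℝ) : OnePoint ℝ)]
    ![(g₁ : GL (Fin 2) ℝ) • ((0 : ℝ) : OnePoint ℝ), (g₁ : GL (Fin 2) ℝ) • (∞ : OnePoint ℝ)]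
  refine ⟨γ, hγ, fun e ↦ H 0 ?_, fun e ↦ H 1 ?_⟩
  · rw [← toGL_smul_infty_eq_zero_iff, map_mul, map_mul, mul_smul, mul_smul, map_inv,
      inv_smul_eq_iff] at e
    exact e
  · rw [← toGL_smul_zero_eq_infty_iff, map_mul, map_mul, mul_smul, mul_smul, map_inv,
      inv_smul_eq_iff] at e
    exact e

/-- For `|a| > 1` the factor `(a²)⁻¹` is the contraction of lower unipotents in backward time; the
next lemma is its forward counterpart for upper unipotents. -/
theorem lowerSL_mul_diagSL_inv (a : ℝˣ) (x : ℝ) :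
    lowerSL x * diagSL a⁻¹ = diagSL a⁻¹ * lowerSL (((a : ℝ) ^ 2)⁻¹ * x) := by
  have := a.ne_zero
  apply sl_ext <;> simp [sl_mul_apply, -map_inv]
  field_simp

theorem upperSL_mul_diagSL (a : ℝˣ) (x : ℝ) :
    upperSL x * diagSL a = diagSL a * upperSL (((a : ℝ) ^ 2)⁻¹ * x) := by
  have := a.ne_zero
  apply sl_ext <;> simp [sl_mul_apply]
  field_simp

theorem tendsto_pow_sq_inv {a : ℝˣ} (ha : 1 < |(a : ℝ)|) :
    Tendsto (fun n : ℕ ↦ (((a ^ n : ℝˣ) : ℝ) ^ 2)⁻¹) atTop (𝓝 0) := by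
  have : Tendsto (fun n : ℕ ↦ ((|(a : ℝ)| ^ n) ^ 2)) atTop atTop :=
    (tendsto_pow_atTop two_ne_zero).comp (tendsto_pow_atTop_atTop_of_one_lt ha)
  refine this.inv_tendsto_atTop.congr fun n ↦ ?_
  simp [← abs_pow, sq_nonneg]

/-- The geodesic which is backward asymptotic to an axis and forward asymptotic to another axis
is nonwandering. -/
theorem mem_nonwanderingSet_of_asymptotic {g₁ g₂ : SL(2, ℝ)} {a b κ : ℝˣ} {l r : ℝ}
    (ha : 1 < |(a : ℝ)|) (hb : 1 < |(b : ℝ)|)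
    (hg₁ : g₁ * diagSL a * g₁⁻¹ ∈ Γ) (hg₂ : g₂ * diagSL b * g₂⁻¹ ∈ Γ)
    (hk : g₁⁻¹ * g₂ = lowerSL l * diagSL κ * upperSL r) (h₁₁ : (g₁⁻¹ * g₂) 1 1 ≠ 0) :
    ofFrame Γ (g₁ * lowerSL l) ∈ nonwanderingSet (geodesicFlow Γ) := by
  have hκ := κ.ne_zero
  set z := g₁ * lowerSL l with hz
  -- The returning elements are `γ₂ⁿγ₁ⁿ`: follow the first axis, then the second.
  let M (n : ℕ) : SL(2, ℝ) :=
    z⁻¹ * ((g₂ * diagSL (b ^ n) * g₂⁻¹) * (g₁ * diagSL (a ^ n) * g₁⁻¹)) * z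
  have hM (n : ℕ) : z * M n * z⁻¹ ∈ Γ := by
    convert mul_mem (conj_diagSL_pow_mem hg₂ n) (conj_diagSL_pow_mem hg₁ n) using 1
    simp only [M]; group
  have hg : g₂ = z * (diagSL κ * upperSL r) := by
    rw [hz, mul_assoc, ← mul_assoc (lowerSL l), ← hk, mul_inv_cancel_left]
  have hM' (n : ℕ) : M n = diagSL κ * upperSL r * diagSL (b ^ n) * upperSL (-r) * diagSL κ⁻¹ *
      lowerSL (-l) * diagSL (a ^ n) * lowerSL l := by
    have hg1 : g₁ = z * lowerSL (-l) := by rw [hz, ← lowerSL_inv, mul_inv_cancel_right]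
    simp only [M]
    rw [hg, hg1]
    simp only [mul_inv_rev, ← upperSL_inv, ← lowerSL_inv, map_inv]
    group
  rw [hk] at h₁₁
  simp [sl_mul_apply] at h₁₁
  -- The entries of `M n` used below are `s n = (ab)ⁿ` times a polynomial in `u = a⁻²ⁿ` and `v =
  -- b⁻²ⁿ`, both tending to zero. At `u = v = 0` only the entry `0 0` survives, with value `κ` times
  -- the entry `1 1` of `g₁⁻¹ * g₂`.
  set u : ℕ → ℝ := fun n ↦ (((a ^ n : ℝˣ) : ℝ) ^ 2)⁻¹ with hu
  set v : ℕ → ℝ := fun n ↦ (((b ^ n : ℝˣ) : ℝ) ^ 2)⁻¹ with hv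
  set s : ℕ → ℝ := fun n ↦ ((b ^ n : ℝˣ) : ℝ) * ((a ^ n : ℝˣ) : ℝ) with hs
  have hu0 : Tendsto u atTop (𝓝 0) := tendsto_pow_sq_inv ha
  have hv0 : Tendsto v atTop (𝓝 0) := tendsto_pow_sq_inv hb
  have e00 (n : ℕ) : M n 0 0 = s n * (κ * (l * κ * r + (κ : ℝ)⁻¹ - u n * κ * r * l) +
      κ * r * (u n * v n * κ * l - v n * l * κ)) := by
    have h1 := (a ^ n).ne_zero
    have h2 := (b ^ n).ne_zero
    rw [hM']
    simp only [sl_mul_apply, hu, hv, hs]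
    generalize a ^ n = x at *
    generalize b ^ n = y at *
    simp [-map_inv]
    field_simp
    ring
  have e01 (n : ℕ) : M n 0 1 = s n * (u n * v n * κ ^ 2 * r - u n * κ ^ 2 * r) := by
    have h1 := (a ^ n).ne_zero
    have h2 := (b ^ n).ne_zero
    rw [hM']
    simp only [sl_mul_apply, hu, hv, hs]
    generalize a ^ n = x at *
    generalize b ^ n = y at *
    simp [-map_inv]
    field_simp
    ring
  have e10 (n : ℕ) : M n 1 0 = s n * (u n * v n * l - v n * l) := by
    have h1 := (a ^ n).ne_zero
    have h2 := (b ^ n).ne_zero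
    rw [hM']
    simp only [sl_mul_apply, hu, hv, hs]
    generalize a ^ n = x at *
    generalize b ^ n = y at *
    simp [-map_inv]
    field_simp
    ring
  have hsn (n : ℕ) : s n ≠ 0 := mul_ne_zero (Units.ne_zero _) (Units.ne_zero _)
  have hs_top : Tendsto (fun n ↦ |s n|) atTop atTop := by
    refine ((tendsto_pow_atTop_atTop_of_one_lt hb).atTop_mul_atTop₀
      (tendsto_pow_atTop_atTop_of_one_lt ha)).congr fun n ↦ ?_
    simp [hs, abs_mul, abs_pow]
  have huv : Tendsto (fun n ↦ (u n, v n)) atTop (𝓝 (0, 0)) := hu0.prodMk_nhds hv0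
  have lim (F : ℝ × ℝ → ℝ) (hF : Continuous F) :
      Tendsto (fun n ↦ F (u n, v n)) atTop (𝓝 (F (0, 0))) := (hF.tendsto _).comp huv
  have l00 := lim (fun x ↦ κ * (l * κ * r + (κ : ℝ)⁻¹ - x.1 * κ * r * l) +
      κ * r * (x.1 * x.2 * κ * l - x.2 * l * κ)) (by fun_prop)
  have l01 := lim (fun x ↦ x.1 * x.2 * κ ^ 2 * r - x.1 * κ ^ 2 * r) (by fun_prop)
  have l10 := lim (fun x ↦ x.1 * x.2 * l - x.2 * l) (by fun_prop)
  simp only [zero_mul, sub_zero, mul_zero, add_zero] at l00 l01 l10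
  have hne : (κ : ℝ) * (l * κ * r + (κ : ℝ)⁻¹) ≠ 0 := mul_ne_zero hκ h₁₁
  refine mem_nonwanderingSet_of_tendsto M hM ?_ ?_ ?_
  · simp only [e00, abs_mul (s _)]
    exact hs_top.atTop_mul_pos (abs_pos.mpr hne) l00.abs
  · simp only [e00, e01, mul_div_mul_left _ _ (hsn _)]
    have := l01.div l00 hne
    rwa [zero_div] at this
  · simp only [e00, e10, mul_div_mul_left _ _ (hsn _)]
    have := l10.div l00 hne
    rwa [zero_div] at this

/-- The set of orbits from a neighbourhood of a periodic vector to a neighbourhood of another one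
contains an orbit in the nonwandering set. -/
theorem IsNonelementary.exists_mem_nonwanderingSet_of_isAxisFrame (h : IsNonelementary Γ)
    {g₁ g₂ : SL(2, ℝ)} (h₁ : IsAxisFrame Γ g₁) (h₂ : IsAxisFrame Γ g₂)
    {U V : Set (SurfaceUnitTangent Γ)} (hU : U ∈ 𝓝 (ofFrame Γ g₁)) (hV : V ∈ 𝓝 (ofFrame Γ g₂)) :
    ∃ x ∈ nonwanderingSet (geodesicFlow Γ), x ∈ U ∧ ∃ t : ℝ, 0 ≤ t ∧ geodesicFlow Γ t x ∈ V := by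
  obtain ⟨γ, hγ, h00, h11⟩ := h.exists_conj_entries_ne_zero g₁ g₂
  obtain ⟨a, ha, hg₁⟩ := h₁
  obtain ⟨b, hb, hg₂⟩ := h₂
  have hg₂' : (γ * g₂) * diagSL b * (γ * g₂)⁻¹ ∈ Γ := by
    convert mul_mem (mul_mem hγ hg₂) (inv_mem hγ) using 1
    group
  rw [← ofFrame_mul hγ] at hV
  set k := γ * g₂
  set κ : ℝˣ := Units.mk0 _ h00
  obtain ⟨l, r, hk⟩ : ∃ l r, g₁⁻¹ * k = lowerSL l * diagSL κ * upperSL r :=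
    ⟨_, _, eq_lower_mul_diag_mul_upper _ κ rfl⟩
  have hz := mem_nonwanderingSet_of_asymptotic ha hb hg₁ hg₂' hk h11
  have hzk : g₁ * lowerSL l * diagSL κ = k * upperSL (-r) := by
    rw [← upperSL_inv, eq_mul_inv_iff_mul_eq, mul_assoc, mul_assoc, ← mul_assoc (lowerSL l), ← hk,
      mul_inv_cancel_left]
  have hback (n : ℕ) : ofFrame Γ (g₁ * lowerSL l * diagSL (a ^ n)⁻¹) =
      ofFrame Γ (g₁ * lowerSL ((((a ^ n : ℝˣ) : ℝ) ^ 2)⁻¹ * l)) := by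
    rw [← ofFrame_mul (conj_diagSL_pow_mem hg₁ n), mul_assoc g₁ (lowerSL l), lowerSL_mul_diagSL_inv]
    simp only [map_inv]
    congr 1
    group
  have hforw (n : ℕ) : ofFrame Γ (g₁ * lowerSL l * diagSL (κ * b ^ n)) =
      ofFrame Γ (k * upperSL ((((b ^ n : ℝˣ) : ℝ) ^ 2)⁻¹ * -r)) := by
    rw [map_mul, ← mul_assoc, hzk, mul_assoc k, upperSL_mul_diagSL,
      ← ofFrame_mul (conj_diagSL_pow_mem hg₂' n) (k * upperSL _)]
    congr 1
    group
  have hU' : ∀ᶠ n : ℕ in atTop, ofFrame Γ (g₁ * lowerSL l * diagSL (a ^ n)⁻¹) ∈ U := by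
    simp only [hback]
    have hc : Continuous fun x ↦ ofFrame Γ (g₁ * lowerSL (x * l)) :=
      (continuous_ofFrame Γ).comp ((continuous_lowerSL.comp (by fun_prop)).const_mul g₁)
    refine ((hc.tendsto 0).comp (tendsto_pow_sq_inv ha)).eventually_mem ?_
    simpa [lowerSL_zero] using hU
  have hV' : ∀ᶠ n : ℕ in atTop, ofFrame Γ (g₁ * lowerSL l * diagSL (κ * b ^ n)) ∈ V := by
    simp only [hforw]
    have hc : Continuous fun x ↦ ofFrame Γ (k * upperSL (x * -r)) :=
      (continuous_ofFrame Γ).comp ((continuous_upperSL.comp (by fun_prop)).const_mul k)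
    refine ((hc.tendsto 0).comp (tendsto_pow_sq_inv hb)).eventually_mem ?_
    simpa [upperSL_zero] using hV
  -- This makes the transit time from `U` to `V` nonnegative.
  have hlarge : ∀ᶠ n : ℕ in atTop, 1 ≤ |(κ : ℝ)| * |(b : ℝ)| ^ n :=
    ((tendsto_pow_atTop_atTop_of_one_lt hb).const_mul_atTop
      (abs_pos.mpr κ.ne_zero)).eventually_ge_atTop 1
  obtain ⟨n, hn1, hn2, hn3⟩ := (hU'.and (hV'.and hlarge)).exists
  refine ⟨_, ?_, hn1, 2 * Real.log |((a ^ n * (κ * b ^ n) : ℝˣ) : ℝ)|, ?_, ?_⟩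
  · rw [ofFrame_mul_diagSL]
    exact geodesicFlow_mem_nonwanderingSet hz _
  · refine mul_nonneg two_pos.le (Real.log_nonneg ?_)
    simp only [Units.val_mul, Units.val_pow_eq_pow_val, abs_mul, abs_pow]
    exact one_le_mul_of_one_le_of_one_le (one_le_pow₀ ha.le) hn3
  · rw [← ofFrame_mul_diagSL, mul_assoc, ← map_mul, inv_mul_cancel_left]
    exact hn2

/-! ### Transitivity and the Baire category argument. -/

theorem exists_isAxisFrame_mem_of_isOpen {U : Set (SurfaceUnitTangent Γ)} (hU : IsOpen U)
    (h : (nonwanderingSet (geodesicFlow Γ) ∩ U).Nonempty) :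
    ∃ g, IsAxisFrame Γ g ∧ ofFrame Γ g ∈ U := by
  obtain ⟨x, hx, hxU⟩ := h
  obtain ⟨g, rfl⟩ := (isOpenQuotientMap_ofFrame Γ).surjective x
  obtain ⟨k, hk, hk'⟩ := exists_isAxisFrame_of_mem_nonwanderingSet hx
    ((continuous_ofFrame Γ).continuousAt.preimage_mem_nhds (hU.mem_nhds hxU))
  exact ⟨k, hk', hk⟩

theorem IsNonelementary.exists_mem_nonwanderingSet (h : IsNonelementary Γ)
    {U V : Set (SurfaceUnitTangent Γ)} (hU : IsOpen U) (hV : IsOpen V)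
    (hU' : (nonwanderingSet (geodesicFlow Γ) ∩ U).Nonempty)
    (hV' : (nonwanderingSet (geodesicFlow Γ) ∩ V).Nonempty) :
    ∃ x ∈ nonwanderingSet (geodesicFlow Γ), x ∈ U ∧ ∃ t : ℝ, 0 ≤ t ∧ geodesicFlow Γ t x ∈ V := by
  obtain ⟨g₁, h₁, hg₁⟩ := exists_isAxisFrame_mem_of_isOpen hU hU'
  obtain ⟨g₂, h₂, hg₂⟩ := exists_isAxisFrame_mem_of_isOpen hV hV'
  exact h.exists_mem_nonwanderingSet_of_isAxisFrame h₁ h₂ (hU.mem_nhds hg₁) (hV.mem_nhds hg₂)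

/-- The preimage in `SL(2, ℝ)` is closed, hence locally compact and Baire, and the Baire property
descends along open quotient maps. -/
instance : BaireSpace (nonwanderingSet (geodesicFlow Γ)) := by
  have : LocallyCompactSpace (ofFrame Γ ⁻¹' nonwanderingSet (geodesicFlow Γ)) :=
    ((isClosed_nonwanderingSet _).preimage
      (continuous_ofFrame Γ)).isClosedEmbedding_subtypeVal.locallyCompactSpace
  exact ((isOpenQuotientMap_ofFrame Γ).restrictPreimage _).baireSpace

theorem IsNonelementary.exists_dense_isGδ (h : IsNonelementary Γ) :
    ∃ G : Set (nonwanderingSet (geodesicFlow Γ)), IsGδ G ∧ Dense G ∧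
      ∀ v ∈ G, nonwanderingSet (geodesicFlow Γ) ⊆ closure (forwardOrbit (geodesicFlow Γ) v.1) := by
  set N := nonwanderingSet (geodesicFlow Γ)
  let B := {V ∈ TopologicalSpace.countableBasis (SurfaceUnitTangent Γ) | (N ∩ V).Nonempty}
  have hB : B.Countable := (TopologicalSpace.countable_countableBasis _).mono (Set.sep_subset _ _)
  have hBo {V} (hV : V ∈ B) : IsOpen V := TopologicalSpace.isOpen_of_mem_countableBasis hV.1
  let W (V : Set (SurfaceUnitTangent Γ)) : Set N := {x | ∃ t : ℝ, 0 ≤ t ∧ geodesicFlow Γ t x.1 ∈ V}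
  have hWo : ∀ V ∈ B, IsOpen (W V) := by
    intro V hV
    have : W V = ⋃ t : ℝ, ⋃ _ : 0 ≤ t, (fun x : N ↦ geodesicFlow Γ t x.1) ⁻¹' V := by
      ext x; simp [W]
    rw [this]
    exact isOpen_iUnion fun t ↦ isOpen_iUnion fun _ ↦
      (hBo hV).preimage ((continuous_geodesicFlow t).comp continuous_subtype_val)
  have hWd : ∀ V ∈ B, Dense (W V) := by
    intro V hV
    rw [dense_iff_inter_open]
    rintro _ ⟨U, hU, rfl⟩ ⟨x, hx⟩
    obtain ⟨y, hy, hyU, hyV⟩ := h.exists_mem_nonwanderingSet hU (hBo hV) ⟨x.1, x.2, hx⟩ hV.2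
    exact ⟨⟨y, hy⟩, hyU, hyV⟩
  refine ⟨⋂ V ∈ B, W V, .biInter hB fun V hV ↦ (hWo V hV).isGδ,
    dense_biInter_of_isOpen hWo hB hWd, ?_⟩
  intro v hv x hx
  rw [(TopologicalSpace.isBasis_countableBasis _).mem_closure_iff]
  intro V hV hxV
  obtain ⟨t, ht, htV⟩ := Set.mem_iInter₂.mp hv V ⟨hV, x, hx, hxV⟩
  exact ⟨_, htV, t, ht, rfl⟩

/-! ### Vectors pointing into a cusp -/

/-- A matrix mapping `∞` to the given boundary point and preserving the normalization of the
horocycles. -/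
noncomputable def cuspFrame : OnePoint ℝ → SL(2, ℝ)
  | ∞ => 1
  | (x : ℝ) => ⟨!![x, -1; 1, 0], by simp [Matrix.det_fin_two_of]⟩

theorem cuspFrame_smul_infty (ξ : OnePoint ℝ) : (cuspFrame ξ : GL (Fin 2) ℝ) • ∞ = ξ := by
  induction ξ using OnePoint.rec with
  | infty => simp [cuspFrame]
  | coe x =>
    rw [OnePoint.smul_infty_eq_ite]
    change (if (1 : ℝ) = 0 then (∞ : OnePoint ℝ) else ((x / 1 : ℝ) : OnePoint ℝ)) = _
    simp

theorem horoHeight_cuspFrame_smul (ξ : OnePoint ℝ) (w : ℍ) :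
    horoHeight ξ (cuspFrame ξ • w) = w.im := by
  induction ξ using OnePoint.rec with
  | infty => simp [cuspFrame, horoHeight]
  | coe x =>
    have hw : (w : ℂ) ≠ 0 := UpperHalfPlane.ne_zero w
    have hd : den (cuspFrame x) w = w := by simp [den, cuspFrame]
    have hz : ((cuspFrame x • w : ℍ) : ℂ) - x = -1 / w := by
      rw [UpperHalfPlane.coe_specialLinearGroup_apply]
      simp [cuspFrame]
      field_simp
      ring
    have : ‖(w : ℂ)‖ ≠ 0 := norm_ne_zero_iff.mpr hw
    simp only [horoHeight, hz, im_smul_eq, hd]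
    simp
    field_simp

/-- After conjugation to `∞` the parabolic is `±` a unipotent. Squaring removes the sign, and
passing to the inverse if necessary makes the translation positive. -/
theorem IsParabolicFixedPoint.exists_conj_upperSL_mem {ξ : OnePoint ℝ}
    (h : IsParabolicFixedPoint Γ ξ) :
    ∃ τ > 0, cuspFrame ξ * upperSL τ * (cuspFrame ξ)⁻¹ ∈ Γ := by
  obtain ⟨P, hP, hpar, hfix⟩ := h
  set f := cuspFrame ξ
  set Q := f⁻¹ * P * f with hQ
  have hQ' : (Q : GL (Fin 2) ℝ).IsParabolic := by
    rw [hQ, map_mul, map_mul, map_inv, Matrix.GeneralLinearGroup.isParabolic_conj_iff']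
    exact hpar
  have h10 : Q 1 0 = 0 := by
    have : (Q : GL (Fin 2) ℝ) • (∞ : OnePoint ℝ) = ∞ := by
      rw [hQ, map_mul, map_mul, map_inv, mul_smul, mul_smul, inv_smul_eq_iff,
        cuspFrame_smul_infty, hfix]
    exact OnePoint.smul_infty_eq_self_iff.mp this
  obtain ⟨h1, h2⟩ := (Matrix.GeneralLinearGroup.isParabolic_iff_of_upperTriangular
    (g := (Q : GL (Fin 2) ℝ)) h10).mp hQ'
  change Q 0 0 = Q 1 1 at h1
  change Q 0 1 ≠ 0 at h2
  have hdet := sl_det Q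
  rw [h10, mul_zero, sub_zero, ← h1] at hdet
  have hQ2 : Q * Q = upperSL (2 * Q 0 0 * Q 0 1) := by
    apply sl_ext <;> simp [sl_mul_apply, h10, ← h1, hdet]
    ring
  have hmem : f * upperSL (2 * Q 0 0 * Q 0 1) * f⁻¹ ∈ Γ := by
    rw [← hQ2, hQ]
    convert mul_mem hP hP using 1
    group
  have h0 : Q 0 0 ≠ 0 := fun h ↦ by simp [h] at hdet
  rcases lt_or_gt_of_ne (mul_ne_zero (mul_ne_zero two_ne_zero h0) h2) with hlt | hgt
  · refine ⟨-(2 * Q 0 0 * Q 0 1), by linarith, ?_⟩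
    rw [← upperSL_inv]
    convert inv_mem hmem using 1
    group
  · exact ⟨_, hgt, hmem⟩

/-- A geodesic ending at a parabolic fixed point, on which there are nonwandering vectors. -/
theorem IsNonelementary.exists_ofFrame_cuspFrame_mem (h : IsNonelementary Γ) {ξ : OnePoint ℝ}
    (hξ : IsParabolicFixedPoint Γ ξ) :
    ∃ x : ℝ, ofFrame Γ (cuspFrame ξ * upperSL x) ∈ nonwanderingSet (geodesicFlow Γ) := by
  obtain ⟨τ, hτ, hmem⟩ := hξ.exists_conj_upperSL_mem
  set f := cuspFrame ξ with hf
  obtain ⟨γ, hγ, hne⟩ : ∃ γ ∈ Γ, (γ : GL (Fin 2) ℝ) • ξ ≠ ξ := by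
    by_contra! hcon
    refine h.2 ξ ((Set.finite_singleton ξ).subset ?_)
    rintro _ ⟨γ, hγ, rfl⟩
    exact hcon γ hγ
  set Q := f⁻¹ * γ * f with hQ
  have hc : Q 1 0 ≠ 0 := by
    intro h0
    refine hne ?_
    have : (Q : GL (Fin 2) ℝ) • (∞ : OnePoint ℝ) = ∞ := OnePoint.smul_infty_eq_self_iff.mpr h0
    rwa [hQ, map_mul, map_mul, map_inv, mul_smul, mul_smul, inv_smul_eq_iff,
      cuspFrame_smul_infty] at this
  -- Here `x = Q⁻¹∞`, so the geodesic comes from `γ⁻¹ξ`. This cancels the growth in `n` of the entry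
  -- `0 1` of `M n`, which represents `pⁿγ` with `p` the parabolic translation by `τ`.
  set x := -(Q 1 1 / Q 1 0) with hx
  have hcx : Q 1 0 * x = -Q 1 1 := by rw [hx]; field_simp
  let M (n : ℕ) : SL(2, ℝ) := upperSL (n * τ - x) * Q * upperSL x
  have hM (n : ℕ) : M n = (upperSL x)⁻¹ * upperSL (n * τ) * Q * upperSL x := by
    rw [upperSL_inv, ← upperSL_add, neg_add_eq_sub]
  have e00 (n : ℕ) : M n 0 0 = n * (τ * Q 1 0) + (Q 0 0 - x * Q 1 0) := by
    simp [M, sl_mul_apply]; ring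
  have e01 (n : ℕ) : M n 0 1 = Q 0 0 * x + Q 0 1 := by
    simp [M, sl_mul_apply]
    linear_combination (n * τ - x) * hcx
  have e10 (n : ℕ) : M n 1 0 = Q 1 0 := by simp [M, sl_mul_apply]
  have htop : Tendsto (fun n ↦ |M n 0 0|) atTop atTop := by
    have h1 : Tendsto (fun n : ℕ ↦ n * |τ * Q 1 0| + -|Q 0 0 - x * Q 1 0|) atTop atTop :=
      tendsto_atTop_add_const_right _ _
        (tendsto_natCast_atTop_atTop.atTop_mul_const (abs_pos.mpr (mul_ne_zero hτ.ne' hc)))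
    refine tendsto_atTop_mono (fun n ↦ ?_) h1
    have := abs_sub_abs_le_abs_sub (n * (τ * Q 1 0)) (-(Q 0 0 - x * Q 1 0))
    rw [abs_neg, sub_neg_eq_add, abs_mul, Nat.abs_cast] at this
    rw [e00]
    linarith
  have hconst (a : ℝ) : Tendsto (fun n ↦ a / M n 0 0) atTop (𝓝 0) := by
    rw [tendsto_zero_iff_abs_tendsto_zero]
    exact (htop.const_div_atTop |a|).congr fun n ↦ (abs_div _ _).symm
  refine ⟨x, mem_nonwanderingSet_of_tendsto M (fun n ↦ ?_) htop ?_ ?_⟩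
  · rw [hM]
    convert mul_mem (pow_mem hmem n) hγ using 1
    rw [conj_pow, upperSL_pow, hQ]
    group
  · simp only [e01]; exact hconst _
  · simp only [e10]; exact hconst _

/-! ### Closed horocycles -/

/-- The parametrization by arc length of the horizontal line at height `y`. -/
def horizontal (y : ℝ) (hy : 0 < y) (s : ℝ) : ℍ := ⟨⟨y * s, y⟩, hy⟩

theorem coe_horizontal {y : ℝ} (hy : 0 < y) (s : ℝ) :
    (horizontal y hy s : ℂ) = y * s + y * Complex.I := by
  apply Complex.ext <;> simp [horizontal]

theorem im_horizontal {y : ℝ} (hy : 0 < y) (s : ℝ) : (horizontal y hy s).im = y := rfl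

theorem coe_upperSL_smul (x : ℝ) (w : ℍ) : ((upperSL x • w : ℍ) : ℂ) = w + x := by
  rw [UpperHalfPlane.coe_specialLinearGroup_apply]
  simp

theorem upperSL_smul_horizontal {y : ℝ} (hy : 0 < y) (s l : ℝ) :
    upperSL (y * l) • horizontal y hy s = horizontal y hy (s + l) := by
  apply UpperHalfPlane.ext
  rw [coe_upperSL_smul, coe_horizontal, coe_horizontal]
  push_cast; ring

theorem isArcLengthParametrization_horocycle (ξ : OnePoint ℝ) {y : ℝ} (hy : 0 < y) :
    IsArcLengthParametrization (fun s ↦ cuspFrame ξ • horizontal y hy s) (horocycle ξ y) where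
  injective s t e := by
    have := congrArg UpperHalfPlane.re (MulAction.injective (cuspFrame ξ) e)
    change y * s = y * t at this
    exact mul_left_cancel₀ hy.ne' this
  range_eq := by
    ext z
    obtain ⟨w, rfl⟩ := MulAction.surjective (cuspFrame ξ) z
    simp only [Set.mem_range, horocycle, Set.mem_ofPred_eq, horoHeight_cuspFrame_smul,
      smul_left_cancel_iff]
    constructor
    · rintro ⟨s, rfl⟩
      exact im_horizontal hy s
    · rintro rfl
      refine ⟨w.re / w.im, UpperHalfPlane.ext ?_⟩
      have := w.im_ne_zero
      apply Complex.ext <;> simp [horizontal]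
      field_simp
  unit_speed s := by
    set f := cuspFrame ξ
    have hw : HasDerivAt (fun s' : ℝ ↦ (horizontal y hy s' : ℂ)) y s := by
      simp only [coe_horizontal]
      have := ((Complex.ofRealCLM.hasDerivAt (x := s)).const_mul (y : ℂ)).add_const
        ((y : ℂ) * Complex.I)
      simpa using this
    have hd := den_ne_zero f (horizontal y hy s)
    have hdet : ((f 0 0 : ℝ) : ℂ) * (f 1 1 : ℝ) - (f 0 1 : ℝ) * (f 1 0 : ℝ) = 1 := by
      exact_mod_cast sl_det f
    refine ⟨y / den f (horizontal y hy s) ^ 2, ?_, ?_⟩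
    · have := ((hw.const_mul ((f 0 0 : ℝ) : ℂ)).add_const ((f 0 1 : ℝ) : ℂ)).div
        ((hw.const_mul ((f 1 0 : ℝ) : ℂ)).add_const ((f 1 1 : ℝ) : ℂ)) hd
      refine (this.congr_of_eventuallyEq (.of_forall fun s' ↦
        UpperHalfPlane.coe_specialLinearGroup_apply f (horizontal y hy s'))).congr_deriv ?_
      simp only [den]
      congr 1
      linear_combination (y : ℂ) * hdet
    · rw [im_smul_eq, im_horizontal, norm_div, norm_pow, Complex.norm_real, Real.norm_eq_abs,
        abs_of_pos hy]

/-- After undoing the translation, the matrix fixes a horizontal line pointwise, hence is `±1`;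
squaring disposes of the sign. -/
theorem mul_self_eq_upperSL_of_smul_horizontal {Q : SL(2, ℝ)} {y l : ℝ} (hy : 0 < y)
    (h : ∀ s, Q • horizontal y hy s = horizontal y hy (s + l)) :
    Q * Q = upperSL (2 * (y * l)) := by
  set R := upperSL (-(y * l)) * Q with hR
  have hfix (s : ℝ) : R • horizontal y hy s = horizontal y hy s := by
    rw [hR, mul_smul, h, ← upperSL_inv, inv_smul_eq_iff, upperSL_smul_horizontal]
  have heq (s : ℝ) : (R 0 0 : ℂ) * (y * s + y * Complex.I) + R 0 1 =
      (y * s + y * Complex.I) * (R 1 0 * (y * s + y * Complex.I) + R 1 1) := by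
    have h1 := congrArg UpperHalfPlane.coe (hfix s)
    have hd := den_ne_zero R (horizontal y hy s)
    simp only [den] at hd
    rw [UpperHalfPlane.coe_specialLinearGroup_apply, coe_horizontal] at h1
    rw [coe_horizontal] at hd
    exact (div_eq_iff hd).mp h1
  have i0 := congrArg Complex.im (heq 0)
  have r0 := congrArg Complex.re (heq 0)
  have i1 := congrArg Complex.im (heq 1)
  simp at i0 r0 i1
  have hQ : Q = upperSL (y * l) * R := by rw [hR, ← upperSL_inv, mul_inv_cancel_left]
  have h1 : R 0 0 = R 1 1 := mul_right_cancel₀ hy.ne' (by linarith)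
  have h2 : R 1 0 = 0 := by
    have : R 1 0 * (2 * y * y) = 0 := by rw [h1] at i1; linarith
    simpa [hy.ne'] using this
  have h3 : R 0 1 = 0 := by simpa [h2] using r0
  have hdet := sl_det R
  rw [h1, h2, mul_zero, sub_zero] at hdet
  rw [hQ]
  apply sl_ext <;> simp [sl_mul_apply, h1, h2, h3, hdet]
  linear_combination (2 * (y * l)) * hdet

theorem finite_setOf_conj_upperSL_mem (hΓ : DiscreteTopology Γ) (f : SL(2, ℝ)) (a b : ℝ) :
    {x ∈ Set.Icc a b | f * upperSL x * f⁻¹ ∈ Γ}.Finite := by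
  have hinj : Function.Injective fun x ↦ f * upperSL x * f⁻¹ := by
    intro x z e
    have := mul_left_cancel (mul_right_cancel e)
    simpa using congrArg (fun g : SL(2, ℝ) ↦ g 0 1) this
  have hcont : Continuous fun x ↦ f * upperSL x * f⁻¹ :=
    (continuous_upperSL.const_mul f).mul_const _
  have hK := isCompact_Icc (a := a) (b := b).image hcont
  let _ := IsTopologicalGroup.rightUniformSpace SL(2, ℝ)
  have hfin := Subgroup.tendsto_coe_cofinite_of_discrete Γ
    (isDiscrete_iff_discreteTopology.mpr hΓ) hK.compl_mem_cocompact
  rw [mem_map, mem_cofinite] at hfin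
  refine ((hfin.image Subtype.val).preimage hinj.injOn).subset ?_
  rintro x ⟨hx, hxΓ⟩
  exact ⟨⟨_, hxΓ⟩, fun hn ↦ hn ⟨x, hx, rfl⟩, rfl⟩

/-- Translation by `τ` at height `y` moves points by arc length `τ / y`. Discreteness leaves
finitely many smaller candidates, so a least length exists. -/
theorem exists_isClosedHorocycle (hΓ : DiscreteTopology Γ) {ξ : OnePoint ℝ} {τ y : ℝ}
    (hτ : 0 < τ) (hmem : cuspFrame ξ * upperSL τ * (cuspFrame ξ)⁻¹ ∈ Γ) (hy : 0 < y) :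
    ∃ ℓ ≤ τ / y, IsClosedHorocycle Γ (toSurface Γ '' horocycle ξ y) ℓ := by
  set f := cuspFrame ξ with hf
  set S := {l : ℝ | 0 < l ∧ ∃ γ ∈ Γ, ∀ s : ℝ,
    γ • (f • horizontal y hy s) = f • horizontal y hy (s + l)} with hS
  have hτS : τ / y ∈ S := by
    refine ⟨by positivity, _, hmem, fun s ↦ ?_⟩
    rw [← mul_smul, inv_mul_cancel_right, mul_smul, ← upperSL_smul_horizontal,
      mul_div_cancel₀ _ hy.ne']
  have hfin : (S ∩ Set.Iic (τ / y)).Finite := by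
    have hinj : Function.Injective fun l : ℝ ↦ 2 * (y * l) := fun a b e ↦ by
      have := mul_left_cancel₀ two_ne_zero e
      exact mul_left_cancel₀ hy.ne' this
    -- The bound is `2 * τ` because the squares `γ * γ` are counted, translating by `2 * (y * l)`.
    refine ((finite_setOf_conj_upperSL_mem hΓ f 0 (2 * τ)).preimage hinj.injOn).subset ?_
    rintro l ⟨⟨hl, γ, hγ, h⟩, hlτ⟩
    rw [Set.mem_Iic, le_div_iff₀ hy] at hlτ
    refine ⟨⟨by positivity, by linarith⟩, ?_⟩
    rw [← mul_self_eq_upperSL_of_smul_horizontal (Q := f⁻¹ * γ * f) hy fun s ↦ by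
      rw [mul_smul, mul_smul, h, inv_smul_smul]]
    convert mul_mem hγ hγ using 1
    group
  obtain ⟨ℓ, ⟨hℓS, hℓτ⟩, hmin⟩ := hfin.exists_minimal ⟨_, hτS, Set.mem_Iic.mpr le_rfl⟩
  refine ⟨ℓ, hℓτ, ξ, y, _, hy, isArcLengthParametrization_horocycle ξ hy, rfl, hℓS, ?_⟩
  intro l hl
  rcases le_total l (τ / y) with hle | hle
  · by_contra hlt
    exact hlt (hmin ⟨hl, hle⟩ (not_le.mp hlt).le)
  · exact hℓτ.trans hle

/-! ### Cusp-recurrence -/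

theorem isOpenQuotientMap_toSurface : IsOpenQuotientMap (toSurface Γ) :=
  MulAction.isOpenQuotientMap_quotientMk (Γ := Γ) (T := ℍ)

theorem basePoint_ofFrame (g : SL(2, ℝ)) :
    basePoint Γ (ofFrame Γ g) = toSurface Γ (g • UpperHalfPlane.I) := by
  rw [← pt_vertical_zero]; rfl

theorem continuous_basePoint : Continuous (basePoint Γ) := by
  rw [← (isOpenQuotientMap_ofFrame Γ).continuous_comp_iff]
  have : basePoint Γ ∘ ofFrame Γ = fun g ↦ toSurface Γ (g • UpperHalfPlane.I) :=
    funext basePoint_ofFrame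
  rw [this]
  exact isOpenQuotientMap_toSurface.continuous.comp (by fun_prop)

theorem exists_isClosedHorocycle_of_dense (hΓ : DiscreteTopology Γ) (hne : IsNonelementary Γ)
    {ξ : OnePoint ℝ} (hξ : IsParabolicFixedPoint Γ ξ) {u : SurfaceUnitTangent Γ}
    (hu : nonwanderingSet (geodesicFlow Γ) ⊆ closure (forwardOrbit (geodesicFlow Γ) u))
    {ε : ℝ} (hε : 0 < ε) :
    ∃ (C : Set (Surface Γ)) (ℓ : ℝ), IsClosedHorocycle Γ C ℓ ∧ ℓ < ε ∧
      ∃ t : ℝ, 0 ≤ t ∧ basePoint Γ (geodesicFlow Γ t u) ∈ C := by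
  obtain ⟨τ, hτ, hmem⟩ := hξ.exists_conj_upperSL_mem
  obtain ⟨x, hx⟩ := hne.exists_ofFrame_cuspFrame_mem hξ
  set f := cuspFrame ξ with hf
  have hO : IsOpen (basePoint Γ ⁻¹' (toSurface Γ '' {z | τ / ε < (f⁻¹ • z).im})) :=
    (isOpenQuotientMap_toSurface.isOpenMap _ (isOpen_lt continuous_const
      (UpperHalfPlane.continuous_im.comp (continuous_const_smul _)))).preimage continuous_basePoint
  -- The vector with frame `f * upperSL x * diagSL b` is based at height `b ^ 2`, which exceeds `τ /
  -- ε`.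
  set b : ℝˣ := Units.mk0 (τ / ε + 1) (by positivity)
  have hb : ofFrame Γ (f * upperSL x * diagSL b) ∈ nonwanderingSet (geodesicFlow Γ) := by
    rw [ofFrame_mul_diagSL]
    exact geodesicFlow_mem_nonwanderingSet hx _
  have hbO : ofFrame Γ (f * upperSL x * diagSL b) ∈
      basePoint Γ ⁻¹' (toSurface Γ '' {z | τ / ε < (f⁻¹ • z).im}) := by
    rw [Set.mem_preimage, basePoint_ofFrame]
    refine ⟨_, ?_, rfl⟩
    rw [Set.mem_ofPred_eq, mul_smul, mul_smul, inv_smul_smul]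
    have h1 : (upperSL x • diagSL b • UpperHalfPlane.I).im = (τ / ε + 1) ^ 2 := by
      rw [← UpperHalfPlane.coe_im, coe_upperSL_smul, diagSL_smul_I]
      have : ((b : ℂ) ^ 2) = (((τ / ε + 1) ^ 2 : ℝ) : ℂ) := by simp [b]
      rw [this]
      simp [-Complex.ofReal_pow]
    rw [h1]
    have : 0 < τ / ε := by positivity
    nlinarith
  obtain ⟨_, ⟨z, hz, e⟩, t, ht, rfl⟩ := mem_closure_iff.mp (hu hb) _ hO hbO
  have hy : 0 < (f⁻¹ • z).im := UpperHalfPlane.im_pos _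
  obtain ⟨ℓ, hℓ, hC⟩ := exists_isClosedHorocycle hΓ hτ hmem hy
  refine ⟨_, ℓ, hC, hℓ.trans_lt ?_, t, ht, z, ?_, e⟩
  · rw [div_lt_iff₀ hy, mul_comm]
    exact (div_lt_iff₀ hε).mp hz
  · rw [horocycle, Set.mem_ofPred_eq, ← horoHeight_cuspFrame_smul ξ (f⁻¹ • z), smul_inv_smul]

/-- Leaving every compact set is already impossible, whether or not the orbit ends in a cusp. -/
theorem not_escapesThroughCusp_of_dense (hΓ : DiscreteTopology Γ)
    (hN : (nonwanderingSet (geodesicFlow Γ)).Nonempty) {u : SurfaceUnitTangent Γ}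
    (hu : nonwanderingSet (geodesicFlow Γ) ⊆ closure (forwardOrbit (geodesicFlow Γ) u)) :
    ¬ EscapesThroughCusp Γ u := by
  rintro ⟨hesc, -⟩
  have := t2Space_surfaceUnitTangent hΓ
  obtain ⟨g, hg, -⟩ := exists_isAxisFrame_mem_of_isOpen isOpen_univ (by rwa [Set.inter_univ])
  obtain ⟨L, hL, hLn, hLz⟩ := exists_compact_subset isOpen_univ
    (Set.mem_univ (g • UpperHalfPlane.I))
  set K := toSurface Γ '' L
  have hK : IsCompact K := hL.image isOpenQuotientMap_toSurface.continuous
  have hKn : K ∈ 𝓝 (basePoint Γ (ofFrame Γ g)) := by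
    rw [basePoint_ofFrame]
    exact isOpenQuotientMap_toSurface.isOpenMap.image_mem_nhds (mem_interior_iff_mem_nhds.mp hLn)
  obtain ⟨T, hT⟩ := eventually_atTop.mp (hesc.eventually_mem hK.compl_mem_cocompact)
  have hcl : IsClosed ((fun t ↦ geodesicFlow Γ t u) '' Set.Icc 0 T) :=
    (isCompact_Icc.image (continuous_geodesicFlow_left u)).isClosed
  -- Visits to `K` occur only before time `T`, so the periodic vector is a limit of points of a
  -- compact, hence closed, orbit segment. It therefore lies on the orbit, which then returns to `K`
  -- after time `T`.
  have hx : ofFrame Γ g ∈ (fun t ↦ geodesicFlow Γ t u) '' Set.Icc 0 T := by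
    rw [← hcl.closure_eq, mem_closure_iff_nhds]
    intro V hV
    have hV' := inter_mem hV (continuous_basePoint.continuousAt.preimage_mem_nhds hKn)
    obtain ⟨_, ⟨hyV, hyK⟩, t, ht, rfl⟩ :=
      mem_closure_iff_nhds.mp (hu hg.mem_nonwanderingSet) _ hV'
    refine ⟨_, hyV, t, ⟨ht, ?_⟩, rfl⟩
    by_contra hlt
    exact hT t (not_le.mp hlt).le hyK
  obtain ⟨t, ht, e⟩ := hx
  change geodesicFlow Γ t u = _ at e
  obtain ⟨p, hp, hper⟩ := hg.geodesicFlow_periodic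
  obtain ⟨n, hn⟩ := exists_nat_gt (T / p)
  rw [div_lt_iff₀ hp] at hn
  refine hT (n * p + t) (by linarith [ht.1]) ?_
  rw [geodesicFlow_add, e, hper]
  exact mem_of_mem_nhds hKn

theorem isCuspRecurrent_of_dense (hΓ : DiscreteTopology Γ) (hne : IsNonelementary Γ)
    {ξ : OnePoint ℝ} (hξ : IsParabolicFixedPoint Γ ξ) {u : SurfaceUnitTangent Γ}
    (hu : nonwanderingSet (geodesicFlow Γ) ⊆ closure (forwardOrbit (geodesicFlow Γ) u)) :
    IsCuspRecurrent Γ u :=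
  have ⟨_, hx⟩ := hne.exists_ofFrame_cuspFrame_mem hξ
  ⟨not_escapesThroughCusp_of_dense hΓ ⟨_, hx⟩ hu,
    fun _ hε ↦ exists_isClosedHorocycle_of_dense hΓ hne hξ hu hε⟩

end CuspRecurrence

theorem mainTheorem4 (Γ : Subgroup SL(2, ℝ))
    (hΓ : CuspRecurrence.IsTorsionFreeFuchsian Γ)
    (hne : CuspRecurrence.IsNonelementary Γ)
    (hcusp : ∃ ξ : OnePoint ℝ, CuspRecurrence.IsParabolicFixedPoint Γ ξ) :
    (∀ u : CuspRecurrence.SurfaceUnitTangent Γ,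
      CuspRecurrence.nonwanderingSet (CuspRecurrence.geodesicFlow Γ) ⊆
        closure (CuspRecurrence.forwardOrbit (CuspRecurrence.geodesicFlow Γ) u) →
      CuspRecurrence.IsCuspRecurrent Γ u) ∧
    (∃ v ∈ CuspRecurrence.nonwanderingSet (CuspRecurrence.geodesicFlow Γ),
      CuspRecurrence.nonwanderingSet (CuspRecurrence.geodesicFlow Γ) ⊆
        closure (CuspRecurrence.fullOrbit (CuspRecurrence.geodesicFlow Γ) v)) ∧
    (∃ G : Set (CuspRecurrence.nonwanderingSet (CuspRecurrence.geodesicFlow Γ)),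
      IsGδ G ∧ Dense G ∧
      ∀ v ∈ G,
        CuspRecurrence.nonwanderingSet (CuspRecurrence.geodesicFlow Γ) ⊆
          closure (CuspRecurrence.forwardOrbit (CuspRecurrence.geodesicFlow Γ) v.1) ∧
        CuspRecurrence.IsCuspRecurrent Γ v.1) := by
  obtain ⟨ξ, hξ⟩ := hcusp
  obtain ⟨G, hG, hGd, hGv⟩ := hne.exists_dense_isGδ
  have hrec (u : CuspRecurrence.SurfaceUnitTangent Γ) (hu) :
      CuspRecurrence.IsCuspRecurrent Γ u :=
    CuspRecurrence.isCuspRecurrent_of_dense hΓ.discrete hne hξ hu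
  refine ⟨hrec, ?_, G, hG, hGd, fun v hv ↦ ⟨hGv v hv, hrec v.1 (hGv v hv)⟩⟩
  obtain ⟨x, hx⟩ := hne.exists_ofFrame_cuspFrame_mem hξ
  have : Nonempty (CuspRecurrence.nonwanderingSet (CuspRecurrence.geodesicFlow Γ)) := ⟨⟨_, hx⟩⟩
  obtain ⟨v, hv⟩ := hGd.nonempty
  exact ⟨v.1, v.2, (hGv v hv).trans (closure_mono fun _ ⟨t, _, e⟩ ↦ ⟨t, e⟩)⟩
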